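/- Let $Q$ be a finite quiver with vertex set $I$, let $\mathbf v=(v_i)\in\mathbb Z_{\ge 0}^I$ be a nonzero dimension vector and let $\lambda\in\mathbb C^I$. Let $\overline Q=Q\sqcup Q^{\mathrm{op}}$ be the double quiver, and write $\operatorname{Rep}(\overline Q,\mathbf v)=\bigoplus_{a:i\to j}\operatorname{Hom}(\mathbb C^{v_i},\mathbb C^{v_j})$ (sum over the arrows of $\overline Q$), a point being a pair $(\mathbf x,\mathbf y)$ with $\mathbf x\in\operatorname{Rep}(Q,\mathbf v)$ and $\mathbf y\in\operatorname{Rep}(Q^{\mathrm{op}},\mathbf v)\cong\operatorname{Rep}(Q,\mathbf v)^*$. It carries the symplectic form $\omega((\mathbf x,\mathbf y),(\mathbf x',\mathbf y'))=\sum_{x\in Q}\big(\operatorname{Tr}(y'x)-\operatorname{Tr}(yx')\big)$ of the cotangent bundle, where $y$ is the component of $\mathbf y$ at the reverse arrow $x^*$ of $x$. The group $G_{\mathbf v}=\prod_i GL(v_i)$, with Lie algebra $\mathfrak g_{\mathbf v}$, acts on it by base change, and the diagonal subgroup $\mathbb C^\times$ acts trivially. Let $\mu:\operatorname{Rep}(\overline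 Q,\mathbf v)\to\mathfrak g_{\mathbf v}$, $\mu(\mathbf x,\mathbf y)=\sum(xy-yx)$, be the moment map, and let $\mu^{-1}(\lambda)$ be its scheme-theoretic fiber over $(\lambda_i\mathrm{Id})_{i\in I}$. Let $\Pi_\lambda$ be the preprojective algebra, i.e. the quotient of the path algebra $\mathbb C\overline Q$ by the two-sided ideal generated by $\sum_{x\in Q}(xx^*-x^*x)-\sum_{i\in I}\lambda_i1_i$. Finally let $C_Q=2\,\mathrm{Id}-A_{\overline Q}$, where $A_{\overline Q}$ is the adjacency matrix of $\overline Q$. Let $\mu^{-1}(\lambda)^{\mathrm{reg}}$ be the set of (closed) points at which the scheme $\mu^{-1}(\lambda)$ is smooth over $\mathbb C$ of dimension $\dim\operatorname{Rep}(\overline Q,\mathbf v)-\dim(G_{\mathbf v}/\mathbb C^\times)$, the dimension of the fibers of a submersion $\operatorname{Rep}(\overline Q,\mathbf v)\to(\operatorname{Lie}(G_{\mathbf v}/\mathbb C^\times))^*$. Then: (i) For every simple $\Pi_\lambda$-module $M$ of dimension vector $\mathbf v$ (that is, $\dim 1_iM=v_i$ for all $i$) and every choice of bases of the spaces $1_iM$,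 the corresponding point of $\operatorname{Rep}(\overline Q,\mathbf v)$ lies in $\mu^{-1}(\lambda)^{\mathrm{reg}}$. (ii) The set $\mu^{-1}(\lambda)^{\mathrm{reg}}$ is stable under $G_{\mathbf v}/\mathbb C^\times$, and this group acts freely on it. (iii) Let $\alpha\in\mu^{-1}(\lambda)^{\mathrm{reg}}$. The tangent space $T_\alpha(G_{\mathbf v}\alpha)$ of the orbit (the image of the infinitesimal action of $\mathfrak g_{\mathbf v}$) is contained in the Zariski tangent space $T_\alpha(\mu^{-1}(\lambda))$. The restriction of $\omega$ to $T_\alpha(\mu^{-1}(\lambda))$ descends to a unique bilinear form on the normal space $N_\alpha=T_\alpha(\mu^{-1}(\lambda))/T_\alpha(G_{\mathbf v}\alpha)$, and this form is symplectic (alternating and nondegenerate). Moreover $\dim N_\alpha=2-C_Q\mathbf v\cdot\mathbf v$. -/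

import Mathlib

universe u w t

open scoped Matrix

noncomputable section

namespace QuiverRep

/-! ### Quivers, path algebras, preprojective algebras -/

section PathAlgebra

variable {V : Type u} (Q : Quiver.{w} V)

/-- Generators of the path algebra: the trivial paths `1_i` and the arrows. -/
inductive PathGen : Type (max u w)
  | vertex (i : V) : PathGen
  | arrow {i j : V} (a : Q.Hom i j) : PathGen

variable [Fintype V]

/-- Relations of the path algebra, i.e. of the tensor algebra over `ℂ^V` of the bimodule spanned by
the arrows. An arrow `a : i ⟶ j` satisfies `1_j a 1_i = a`, so that products of arrows are written
like compositions of maps and `a` acts from the `i`-th to the `j`-th component of a left module. -/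
inductive PathRel : FreeAlgebra ℂ (PathGen Q) → FreeAlgebra ℂ (PathGen Q) → Prop
  | idem (i : V) : PathRel
      (FreeAlgebra.ι ℂ (PathGen.vertex i) * FreeAlgebra.ι ℂ (PathGen.vertex i))
      (FreeAlgebra.ι ℂ (PathGen.vertex i))
  | orth (i j : V) (h : i ≠ j) : PathRel
      (FreeAlgebra.ι ℂ (PathGen.vertex i) * FreeAlgebra.ι ℂ (PathGen.vertex j)) 0
  | unit : PathRel (∑ i : V, FreeAlgebra.ι ℂ (PathGen.vertex i)) 1
  | head {i j : V} (a : Q.Hom i j) : PathRel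
      (FreeAlgebra.ι ℂ (PathGen.vertex j) * FreeAlgebra.ι ℂ (PathGen.arrow a))
      (FreeAlgebra.ι ℂ (PathGen.arrow a))
  | tail {i j : V} (a : Q.Hom i j) : PathRel
      (FreeAlgebra.ι ℂ (PathGen.arrow a) * FreeAlgebra.ι ℂ (PathGen.vertex i))
      (FreeAlgebra.ι ℂ (PathGen.arrow a))

/-- The path algebra of a finite quiver over `ℂ`. -/
abbrev PathAlgebra : Type (max u w) := RingQuot (PathRel Q)

variable {Q}

variable (Q) in
/-- The trivial path at `i`. -/
def pathVertex (i : V) : PathAlgebra Q :=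
  RingQuot.mkAlgHom ℂ (PathRel Q) (FreeAlgebra.ι ℂ (PathGen.vertex i))

/-- An arrow, as an element of the path algebra. -/
def pathArrow {i j : V} (a : Q.Hom i j) : PathAlgebra Q :=
  RingQuot.mkAlgHom ℂ (PathRel Q) (FreeAlgebra.ι ℂ (PathGen.arrow a))

theorem pathVertex_mul_pathArrow {i j : V} (a : Q.Hom i j) :
    pathVertex Q j * pathArrow a = pathArrow a := by
  rw [pathVertex, pathArrow, ← map_mul]
  exact RingQuot.mkAlgHom_rel ℂ (PathRel.head a)

end PathAlgebra

section Double

variable {V : Type u}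

/-- The double quiver `Q ⊔ Q^op`. -/
abbrev double (Q : Quiver.{w} V) : Quiver.{w} V := ⟨fun i j => Q.Hom i j ⊕ Q.Hom j i⟩

instance (Q : Quiver.{w} V) [h : ∀ i j : V, Fintype (Q.Hom i j)] (i j : V) :
    Fintype ((double Q).Hom i j) :=
  inferInstanceAs (Fintype (Q.Hom i j ⊕ Q.Hom j i))

/-- The arrow of the double quiver given by an arrow of `Q`. -/
abbrev pos {Q : Quiver.{w} V} {i j : V} (x : Q.Hom i j) : (double Q).Hom i j := Sum.inl x

/-- The reverse arrow `x^*` of the double quiver. -/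
abbrev rev {Q : Quiver.{w} V} {i j : V} (x : Q.Hom i j) : (double Q).Hom j i := Sum.inr x

end Double

section Preprojective

variable {I : Type u} [Fintype I] {Q : Quiver.{w} I} [∀ i j : I, Fintype (Q.Hom i j)]

variable (Q) in
/-- The relation `∑ (x x^* - x^* x) = ∑ λ_i 1_i` in the path algebra of the double quiver. -/
inductive PreprojRel (lam : I → ℂ) :
    PathAlgebra (double Q) → PathAlgebra (double Q) → Prop
  | moment : PreprojRel lam
      (∑ i : I, ∑ j : I, ∑ x : Q.Hom i j,
        (pathArrow (pos x) * pathArrow (rev x) - pathArrow (rev x) * pathArrow (pos x)))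
      (∑ i : I, lam i • pathVertex (double Q) i)

variable (Q) in
/-- The preprojective algebra `Π_λ`: the quotient of the path algebra of the double quiver by the
two-sided ideal generated by `∑ (x x^* - x^* x) - ∑ λ_i 1_i`. -/
abbrev Preproj (lam : I → ℂ) : Type (max u w) := RingQuot (PreprojRel Q lam)

variable (Q) in
/-- The image of `1_i` in `Π_λ`. -/
def preVertex (lam : I → ℂ) (i : I) : Preproj Q lam :=
  RingQuot.mkAlgHom ℂ (PreprojRel Q lam) (pathVertex (double Q) i)

/-- The image of an arrow of the double quiver in `Π_λ`. -/
def preArrow (lam : I → ℂ) {i j : I} (a : (double Q).Hom i j) : Preproj Q lam :=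
  RingQuot.mkAlgHom ℂ (PreprojRel Q lam) (pathArrow a)

theorem preVertex_mul_preArrow (lam : I → ℂ) {i j : I} (a : (double Q).Hom i j) :
    preVertex Q lam j * preArrow lam a = preArrow lam a := by
  rw [preVertex, preArrow, ← map_mul, pathVertex_mul_pathArrow]

end Preprojective

/-! ### Representation spaces and the action of `G_v` -/

section RepSpace

variable {V : Type u} (Q : Quiver.{w} V) (v : V → ℕ)

/-- `Rep(Q, v)` with coefficients in `R`: a matrix `R^{v_i} → R^{v_j}` for every arrow `i ⟶ j`. -/
def RepSpace (R : Type t) : Type (max u w t) :=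
  ∀ i j : V, Q.Hom i j → Matrix (Fin (v j)) (Fin (v i)) R

instance (R : Type t) [CommRing R] : AddCommGroup (RepSpace Q v R) :=
  inferInstanceAs (AddCommGroup (∀ i j : V, Q.Hom i j → Matrix (Fin (v j)) (Fin (v i)) R))

instance (R : Type t) [CommRing R] : Module R (RepSpace Q v R) :=
  inferInstanceAs (Module R (∀ i j : V, Q.Hom i j → Matrix (Fin (v j)) (Fin (v i)) R))

/-- `G_v = ∏ GL(v_i)`. -/
abbrev GroupV (v : V → ℕ) : Type u := ∀ i : V, GL (Fin (v i)) ℂ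

/-- `Lie G_v = ⊕ gl(v_i)`. -/
abbrev LieV (v : V → ℕ) : Type u := ∀ i : V, Matrix (Fin (v i)) (Fin (v i)) ℂ

variable {Q v}

/-- Base change: `(g ρ)_a = g_j ρ_a g_i⁻¹` for `a : i ⟶ j`. -/
instance : MulAction (GroupV v) (RepSpace Q v ℂ) where
  smul g ρ := fun i j a =>
    (g j : Matrix (Fin (v j)) (Fin (v j)) ℂ) * ρ i j a *
      ((g i)⁻¹ : GL (Fin (v i)) ℂ).val
  one_smul ρ := by
    funext i j a
    change ((1 : GL (Fin (v j)) ℂ) : Matrix (Fin (v j)) (Fin (v j)) ℂ) * ρ i j a *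
      ((1 : GL (Fin (v i)) ℂ)⁻¹ : GL (Fin (v i)) ℂ).val = ρ i j a
    simp
  mul_smul g h ρ := by
    funext i j a
    change ((g j * h j : GL (Fin (v j)) ℂ) : Matrix (Fin (v j)) (Fin (v j)) ℂ) * ρ i j a *
      ((g i * h i)⁻¹ : GL (Fin (v i)) ℂ).val = (g j : Matrix (Fin (v j)) (Fin (v j)) ℂ) *
      ((h j : Matrix (Fin (v j)) (Fin (v j)) ℂ) * ρ i j a * ((h i)⁻¹ : GL (Fin (v i)) ℂ).val) *
      ((g i)⁻¹ : GL (Fin (v i)) ℂ).val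
    rw [mul_inv_rev, Units.val_mul, Units.val_mul]
    simp only [Matrix.mul_assoc]

variable (Q v)

/-- The diagonal embedding of the scalars `ℂ^×` into `G_v`. -/
def scalarHom : ℂˣ →* GroupV v :=
  MonoidHom.pi fun i => Units.map (Matrix.scalar (Fin (v i)) : ℂ →+* _).toMonoidHom

/-- The subgroup `ℂ^×` of `G_v`. -/
def scalars : Subgroup (GroupV v) := (scalarHom v).range

instance : (scalars v).Normal where
  conj_mem := by
    rintro _ ⟨c, rfl⟩ g
    refine ⟨c, ?_⟩
    funext i
    apply Units.ext
    have hc : Commute (Matrix.scalar (Fin (v i)) (c : ℂ))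
        (g i : Matrix (Fin (v i)) (Fin (v i)) ℂ) :=
      Matrix.scalar_commute _ (fun _ => Commute.all _ _) _
    change Matrix.scalar (Fin (v i)) (c : ℂ) =
      (g i : Matrix (Fin (v i)) (Fin (v i)) ℂ) * Matrix.scalar (Fin (v i)) (c : ℂ) *
        ((g i)⁻¹ : GL (Fin (v i)) ℂ).val
    rw [← hc.eq, mul_assoc, ← Units.val_mul, mul_inv_cancel, Units.val_one, mul_one]

theorem scalarHom_smul (c : ℂˣ) (ρ : RepSpace Q v ℂ) : scalarHom v c • ρ = ρ := by
  funext i j a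
  change Matrix.scalar (Fin (v j)) (c : ℂ) * ρ i j a *
    Matrix.scalar (Fin (v i)) ((c⁻¹ : ℂˣ) : ℂ) = ρ i j a
  ext k l
  simp [Matrix.scalar_apply]
  field_simp

/-- The action of `G_v / ℂ^×` on `Rep(Q, v)`, as a homomorphism to permutations. -/
def quotientPermHom : GroupV v ⧸ scalars v →* Equiv.Perm (RepSpace Q v ℂ) :=
  QuotientGroup.lift (scalars v) (MulAction.toPermHom (GroupV v) (RepSpace Q v ℂ)) (by
    rintro _ ⟨c, rfl⟩
    ext ρ : 1
    exact scalarHom_smul Q v c ρ)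

/-- The action of `G_v / ℂ^×` on `Rep(Q, v)` induced by the action of `G_v`. -/
instance : MulAction (GroupV v ⧸ scalars v) (RepSpace Q v ℂ) :=
  MulAction.compHom _ (quotientPermHom Q v)

variable {Q v}

/-- The infinitesimal action `u ↦ (u_j ρ_a - ρ_a u_i)_a`, the differential at `1` of the orbit map
`g ↦ g ρ`. -/
def infinitesimalAction (ρ : RepSpace Q v ℂ) : LieV v →ₗ[ℂ] RepSpace Q v ℂ where
  toFun u := fun i j a => u j * ρ i j a - ρ i j a * u i
  map_add' u u' := by
    funext i j a
    change (u j + u' j) * ρ i j a - ρ i j a * (u i + u' i) =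
      (u j * ρ i j a - ρ i j a * u i) + (u' j * ρ i j a - ρ i j a * u' i)
    rw [Matrix.add_mul, Matrix.mul_add]
    abel
  map_smul' c u := by
    funext i j a
    change (c • u j) * ρ i j a - ρ i j a * (c • u i) = c • (u j * ρ i j a - ρ i j a * u i)
    rw [Matrix.smul_mul, Matrix.mul_smul, smul_sub]

/-- The tangent space at `ρ` to the orbit `G_v ρ`. -/
def orbitTangent (ρ : RepSpace Q v ℂ) : Submodule ℂ (RepSpace Q v ℂ) :=
  LinearMap.range (infinitesimalAction ρ)

variable (Q v)

/-- Index set of the linear coordinates (matrix entries) on `Rep(Q, v)`. -/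
abbrev Coord : Type (max u w) := Σ i j : V, Q.Hom i j × Fin (v j) × Fin (v i)

variable {Q v}

/-- The coordinates of a point of `Rep(Q, v)`. -/
def coords {R : Type t} (ρ : RepSpace Q v R) : Coord Q v → R :=
  fun s => ρ s.1 s.2.1 s.2.2.1 s.2.2.2.1 s.2.2.2.2

variable (Q v)

/-- The generic point of `Rep(Q, v)`, whose entries are the coordinate functions. -/
def genericRep : RepSpace Q v (MvPolynomial (Coord Q v) ℂ) :=
  fun i j a => Matrix.of fun k l => MvPolynomial.X ⟨i, j, a, k, l⟩

end RepSpace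

/-- The adjacency matrix: the entry `(i, j)` is the number of arrows from `j` to `i`. -/
def adjacency {V : Type u} (Q : Quiver.{w} V) [∀ i j : V, Fintype (Q.Hom i j)] : Matrix V V ℤ :=
  Matrix.of fun i j => (Fintype.card (Q.Hom j i) : ℤ)

/-! ### The moment map and its fibers -/

section Moment

variable {I : Type u} [Fintype I] (Q : Quiver.{w} I) [∀ i j : I, Fintype (Q.Hom i j)]

/-- The Cartan matrix `C_Q = 2 Id - A`, with `A` the adjacency matrix of the double quiver. -/
def cartan {I : Type u} [DecidableEq I] (Q : Quiver.{w} I) [∀ i j : I, Fintype (Q.Hom i j)] :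
    Matrix I I ℤ :=
  2 • (1 : Matrix I I ℤ) - adjacency (double Q)

/-- `Rep` of the double quiver. -/
abbrev DoubleRep (v : I → ℕ) (R : Type t) : Type (max u w t) :=
  RepSpace (double Q) v R

variable {Q} {v : I → ℕ}

/-- The moment map `(x, y) ↦ ∑ (x y - y x)`, with values in `⊕ gl(v_i)`. -/
def momentMap {R : Type t} [CommRing R] (ρ : DoubleRep Q v R) :
    ∀ i : I, Matrix (Fin (v i)) (Fin (v i)) R := fun i =>
  (∑ j : I, ∑ x : Q.Hom j i, ρ j i (pos x) * ρ i j (rev x)) -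
    ∑ j : I, ∑ x : Q.Hom i j, ρ j i (rev x) * ρ i j (pos x)

variable (Q v)

/-- The set of geometric points of `μ⁻¹(λ)`. -/
def fiber (lam : I → ℂ) : Set (DoubleRep Q v ℂ) :=
  {α | ∀ i : I, momentMap α i = lam i • (1 : Matrix (Fin (v i)) (Fin (v i)) ℂ)}

/-- The ideal of the scheme-theoretic fiber `μ⁻¹(λ)`, generated by the entries of `μ - λ`. -/
def fiberIdeal (lam : I → ℂ) : Ideal (MvPolynomial (Coord (double Q) v) ℂ) :=
  Ideal.span {p | ∃ (i : I) (k l : Fin (v i)),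
    p = (momentMap (genericRep (double Q) v) i -
      (MvPolynomial.C (lam i) : MvPolynomial (Coord (double Q) v) ℂ) • 1) k l}

/-- The coordinate ring of the scheme `μ⁻¹(λ)`. -/
abbrev FiberRing (lam : I → ℂ) : Type (max u w) :=
  MvPolynomial (Coord (double Q) v) ℂ ⧸ fiberIdeal Q v lam

variable {Q v}

/-- The scheme `μ⁻¹(λ)` is smooth over `ℂ` of (relative) dimension `d` at the point `α`: this holds
on the principal open neighbourhood `f ≠ 0` of `α`, for some `f`. -/
def IsSmoothOfDimAt (lam : I → ℂ) (α : DoubleRep Q v ℂ) (d : ℕ) : Prop :=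
  α ∈ fiber Q v lam ∧ ∃ f : MvPolynomial (Coord (double Q) v) ℂ,
    MvPolynomial.eval (coords α) f ≠ 0 ∧
    Algebra.IsStandardSmoothOfRelativeDimension d ℂ
      (Localization.Away (Ideal.Quotient.mk (fiberIdeal Q v lam) f : FiberRing Q v lam))

variable (Q v)

/-- The smooth locus `μ⁻¹(λ)^reg` of the fiber of the moment map
`μ : Rep → (Lie ℂ^×)^⊥ = (Lie (G_v/ℂ^×))^*`: the points where the scheme `μ⁻¹(λ)` is smooth of
the dimension `dim Rep - dim (G_v/ℂ^×)` of a fiber of a submersion. -/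
def smoothLocus (lam : I → ℂ) : Set (DoubleRep Q v ℂ) :=
  {α | ∃ d : ℕ, (d : ℤ) = (Module.finrank ℂ (DoubleRep Q v ℂ) : ℤ) -
      ((Module.finrank ℂ (LieV v) : ℤ) - 1) ∧ IsSmoothOfDimAt lam α d}

variable {Q v}

/-- The Zariski tangent space at `α` of the scheme `μ⁻¹(λ)`, as a subspace of `Rep`: the common
kernel of the differentials at `α` of all the functions in the ideal. -/
def tangentSpace (lam : I → ℂ) (α : DoubleRep Q v ℂ) : Submodule ℂ (DoubleRep Q v ℂ) where
  carrier := {β | ∀ f ∈ fiberIdeal Q v lam,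
    ∑ s, MvPolynomial.eval (coords α) (MvPolynomial.pderiv s f) * coords β s = 0}
  add_mem' {β γ} hβ hγ f hf := by
    have h : ∀ s, coords (β + γ) s = coords β s + coords γ s := fun s => rfl
    simp only [h, mul_add, Finset.sum_add_distrib, hβ f hf, hγ f hf, add_zero]
  zero_mem' f hf := by
    have h : ∀ s, coords (0 : DoubleRep Q v ℂ) s = 0 := fun s => rfl
    simp [h]
  smul_mem' c β hβ f hf := by
    have h : ∀ s, coords (c • β) s = c * coords β s := fun s => rfl
    simp only [h, mul_left_comm _ c, ← Finset.mul_sum, hβ f hf, mul_zero]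

/-- The normal space at `α` to the orbit `G_v α` in `μ⁻¹(λ)`: the quotient of the tangent space of
`μ⁻¹(λ)` by the tangent space of the orbit. -/
abbrev NormalSpace (lam : I → ℂ) (α : DoubleRep Q v ℂ) : Type (max u w) :=
  tangentSpace lam α ⧸ (orbitTangent α).comap (tangentSpace lam α).subtype

variable (Q v)

/-- The canonical symplectic form on `Rep` of the double quiver, that is on `T^* Rep(Q, v)`:
`ω((x, y), (x', y')) = ∑ (Tr (y' x) - Tr (y x'))`. -/
def omega : LinearMap.BilinForm ℂ (DoubleRep Q v ℂ) :=
  LinearMap.mk₂ ℂ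
    (fun β γ => ∑ i : I, ∑ j : I, ∑ x : Q.Hom i j,
      ((γ j i (rev x) * β i j (pos x)).trace - (β j i (rev x) * γ i j (pos x)).trace))
    (by
      intro β β' γ
      have h : ∀ (i j : I) (a : (double Q).Hom i j),
        (β + β') i j a = β i j a + β' i j a := fun _ _ _ => rfl
      simp only [h, Matrix.add_mul, Matrix.mul_add, Matrix.trace_add, ← Finset.sum_add_distrib]
      refine Finset.sum_congr rfl fun i _ => Finset.sum_congr rfl fun j _ =>
        Finset.sum_congr rfl fun x _ => by ring)
    (by
      intro c β γ
      have h : ∀ (i j : I) (a : (double Q).Hom i j),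
        (c • β) i j a = c • β i j a := fun _ _ _ => rfl
      simp only [h, Matrix.smul_mul, Matrix.mul_smul, Matrix.trace_smul, ← smul_sub,
        ← Finset.smul_sum])
    (by
      intro β γ γ'
      have h : ∀ (i j : I) (a : (double Q).Hom i j),
        (γ + γ') i j a = γ i j a + γ' i j a := fun _ _ _ => rfl
      simp only [h, Matrix.add_mul, Matrix.mul_add, Matrix.trace_add, ← Finset.sum_add_distrib]
      refine Finset.sum_congr rfl fun i _ => Finset.sum_congr rfl fun j _ =>
        Finset.sum_congr rfl fun x _ => by ring)
    (by
      intro c β γ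
      have h : ∀ (i j : I) (a : (double Q).Hom i j),
        (c • γ) i j a = c • γ i j a := fun _ _ _ => rfl
      simp only [h, Matrix.smul_mul, Matrix.mul_smul, Matrix.trace_smul, ← smul_sub,
        ← Finset.smul_sum])

end Moment

/-! ### The point of `μ⁻¹(λ)` given by a module -/

section Modules

variable {I : Type u} [Fintype I] {Q : Quiver.{w} I} [∀ i j : I, Fintype (Q.Hom i j)]
variable (lam : I → ℂ) (M : Type t) [AddCommGroup M] [Module ℂ M] [Module (Preproj Q lam) M]
  [IsScalarTower ℂ (Preproj Q lam) M]

/-- The component `1_i M` of a `Π_λ`-module. -/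
def vertexSpace (i : I) : Submodule ℂ M :=
  LinearMap.range (Algebra.lsmul ℂ ℂ M (preVertex Q lam i))

/-- The map `1_i M → 1_j M` given by the action of an arrow `a : i ⟶ j` of the double quiver. -/
def arrowMap {i j : I} (a : (double Q).Hom i j) :
    vertexSpace lam M i →ₗ[ℂ] vertexSpace lam M j :=
  LinearMap.codRestrict (vertexSpace lam M j)
    ((Algebra.lsmul ℂ ℂ M (preArrow lam a)).comp (vertexSpace lam M i).subtype)
    (fun m => ⟨preArrow lam a • (m : M), by
      change preVertex Q lam j • preArrow lam a • (m : M) = preArrow lam a • (m : M)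
      rw [smul_smul, preVertex_mul_preArrow]⟩)

/-- The point of `Rep` of the double quiver given by a `Π_λ`-module `M` and bases of the spaces
`1_i M`. -/
def pointOfModule {v : I → ℕ}
    (b : ∀ i : I, Module.Basis (Fin (v i)) ℂ (vertexSpace lam M i)) : DoubleRep Q v ℂ :=
  fun i j a => LinearMap.toMatrix (b i) (b j) (arrowMap lam M a)

end Modules

end QuiverRep

end

noncomputable section

namespace QuiverRep

/-! ### Jacobian criterion for standard smoothness. -/

section JacobianCriterion

open MvPolynomial

/-! Everything follows from the moment map identity `ω(uα, β) = ∑ Tr(u_i dμ_α(β)_i)`. The trace form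
and `ω` are nondegenerate, so at a point `α` of the fiber the Zariski tangent space `ker dμ_α` is
the `ω`-orthogonal of the orbit tangent space (`tangentSpace_eq_orthogonal`). Its dimension is
therefore `dim Rep - dim g_v + dim ker(u ↦ uα)`, and this kernel always contains the scalars.

The pivot is `mem_smoothLocus_iff`: a point is in the smooth locus iff it lies in the fiber and only
scalars annihilate it infinitesimally. Smoothness of dimension `d` forces the tangent space to have
dimension `d` (`finrank_zariskiTangent`), so the kernel is a line. Conversely, the traces of `μ` sum
to zero, so one diagonal equation is redundant; if only scalars annihilate `α`, the remaining
equations have independent differentials and the Jacobian criterion applies.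

With this description, (i) is Schur's lemma: a tuple `u` with `uα = 0` is a module endomorphism. For
(ii), a group element fixing `α`, read as a tuple of matrices, annihilates `α` infinitesimally,
hence is scalar. For (iii), the orbit tangent space `O` is isotropic because `λ` is central, the
normal space is the linear symplectic reduction `O^⊥/O`, and its dimension is `dim Rep - 2 (dim g_v
- 1)`. -/

theorem isStandardSmooth_away_jacobian {R : Type*} [CommRing R] {σ ρ : Type*} [Finite σ] [Fintype ρ]
    [DecidableEq ρ] (F : ρ → MvPolynomial σ R) (a : ρ → σ) (ha : Function.Injective a)
    {J : Ideal (MvPolynomial σ R)} (hJ : J = Ideal.span (Set.range F)) :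
    Algebra.IsStandardSmoothOfRelativeDimension (Nat.card σ - Nat.card ρ) R
      (Localization.Away (Ideal.Quotient.mk J
        (Matrix.of fun i j => pderiv (a i) (F j)).det)) := by
  subst hJ
  let P := Algebra.PreSubmersivePresentation.naive (v := F) a ha
  let S := MvPolynomial σ R ⧸ Ideal.span (Set.range F)
  let r : S := Ideal.Quotient.mk _ (Matrix.of fun i j => pderiv (a i) (F j)).det
  have hr : P.jacobian = r := by
    rw [Algebra.PreSubmersivePresentation.jacobian_eq_jacobiMatrix_det]
    have : P.jacobiMatrix = Matrix.of fun i j => pderiv (a i) (F j) := by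
      refine Matrix.ext fun i j => ?_
      exact P.jacobiMatrix_apply i j
    rw [this]
    rfl
  let L := Localization.Away r
  -- The naive presentation of the quotient is only pre-submersive. Inverting its own Jacobian `r`
  -- makes it submersive: the Jacobian of the composite is a product of two images of `r`.
  let W := (Algebra.PreSubmersivePresentation.localizationAway L r).comp P
  have hW : IsUnit W.jacobian := by
    rw [Algebra.PreSubmersivePresentation.comp_jacobian_eq_jacobian_smul_jacobian,
      Algebra.smul_def, hr, Algebra.PreSubmersivePresentation.localizationAway_jacobian]
    exact (IsLocalization.Away.algebraMap_isUnit r).mul (IsLocalization.Away.algebraMap_isUnit r)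
  let T : Algebra.SubmersivePresentation R L (Unit ⊕ σ) (Unit ⊕ ρ) := ⟨W, hW⟩
  refine T.isStandardSmoothOfRelativeDimension ?_
  -- The inverse of `r` costs one generator and one relation, which cancel in the relative
  -- dimension.
  change Nat.card (Unit ⊕ σ) - Nat.card (Unit ⊕ ρ) = _
  simp only [Nat.card_sum, Nat.card_unique]
  omega

/-- Jacobian criterion: if the differentials of the equations are linearly independent at a point,
the scheme they define is smooth at this point. -/
theorem exists_isStandardSmooth_away {k : Type*} [Field k] {σ ρ : Type*} [Finite σ] [Finite ρ]
    (F : ρ → MvPolynomial σ k) (p : σ → k)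
    (hF : LinearIndependent k fun e => fun s => eval p (pderiv s (F e)))
    {J : Ideal (MvPolynomial σ k)} (hJ : J = Ideal.span (Set.range F)) :
    ∃ f : MvPolynomial σ k, eval p f ≠ 0 ∧
      Algebra.IsStandardSmoothOfRelativeDimension (Nat.card σ - Nat.card ρ) k
        (Localization.Away (Ideal.Quotient.mk J f)) := by
  classical
  cases nonempty_fintype σ
  cases nonempty_fintype ρ
  let A : Matrix ρ σ k := Matrix.of fun e s => eval p (pderiv s (F e))
  have hA : A.rank = Fintype.card ρ := LinearIndependent.rank_matrix hF
  have hcols : Submodule.span k (Set.range A.col) = ⊤ := by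
    apply Submodule.eq_top_of_finrank_eq
    rw [← Matrix.rank_eq_finrank_span_cols, hA, Module.finrank_fintype_fun_eq_card]
  -- The Jacobian matrix has full row rank, so its columns span; a basis chosen among them gives a
  -- maximal minor that is nonzero at `p`. That minor is `f`.
  obtain ⟨κ, c, hc, hsp, hli⟩ := exists_linearIndependent' k A.col
  let B : Module.Basis κ k (ρ → k) := Module.Basis.mk hli (by rw [hsp, hcols])
  let e : ρ ≃ κ := (Pi.basisFun k ρ).indexEquiv B
  refine ⟨(Matrix.of fun i j => pderiv (c (e i)) (F j)).det, ?_,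
    isStandardSmooth_away_jacobian F (c ∘ e) (hc.comp e.injective) hJ⟩
  rw [RingHom.map_det]
  have hrows : LinearIndependent k fun i : ρ => A.col (c (e i)) :=
    hli.comp e e.injective
  have := (Matrix.linearIndependent_rows_iff_isUnit (A := Matrix.of fun i : ρ => A.col (c (e i)))).1
    hrows
  exact ((Matrix.isUnit_iff_isUnit_det _).1 this).ne_zero

end JacobianCriterion

/-! ### The Zariski tangent space at a smooth point. -/

section ZariskiTangent

open MvPolynomial

variable {k : Type*} [Field k] {σ : Type*} [Fintype σ]

/-- The common kernel of the differentials at `p` of the elements of an ideal. -/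
def zariskiTangent (J : Ideal (MvPolynomial σ k)) (p : σ → k) : Submodule k (σ → k) where
  carrier := {β | ∀ f ∈ J, ∑ s, eval p (pderiv s f) * β s = 0}
  add_mem' {β γ} hβ hγ f hf := by
    simp only [Pi.add_apply, mul_add, Finset.sum_add_distrib, hβ f hf, hγ f hf, add_zero]
  zero_mem' f hf := by simp
  smul_mem' c β hβ f hf := by
    simp only [Pi.smul_apply, smul_eq_mul, mul_left_comm _ c, ← Finset.mul_sum, hβ f hf, mul_zero]

/-- The derivative at `p` in the direction `β`, on polynomials. -/
def dirDeriv (p β : σ → k) : MvPolynomial σ k →ₗ[k] k where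
  toFun f := ∑ s, eval p (pderiv s f) * β s
  map_add' f g := by simp [add_mul, Finset.sum_add_distrib]
  map_smul' c f := by simp [Finset.mul_sum, mul_assoc]

@[simp]
theorem dirDeriv_C (p β : σ → k) (c : k) : dirDeriv p β (C c) = 0 := by simp [dirDeriv]

@[simp]
theorem dirDeriv_X (p β : σ → k) (s : σ) : dirDeriv p β (X s) = β s := by
  classical
  simp [dirDeriv, pderiv_X, Pi.single_apply, apply_ite (eval p), ite_mul]

@[simp]
theorem dirDeriv_mul (p β : σ → k) (f g : MvPolynomial σ k) :
    dirDeriv p β (f * g) = eval p f * dirDeriv p β g + dirDeriv p β f * eval p g := by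
  rw [mul_comm (dirDeriv p β f)]
  simp only [dirDeriv, LinearMap.coe_mk, AddHom.coe_mk, Derivation.leibniz, smul_eq_mul, map_add,
    map_mul, add_mul, Finset.sum_add_distrib, Finset.mul_sum, mul_assoc]

theorem mem_zariskiTangent {J : Ideal (MvPolynomial σ k)} {p β : σ → k} :
    β ∈ zariskiTangent J p ↔ ∀ f ∈ J, dirDeriv p β f = 0 := Iff.rfl

/-- First-order Taylor expansion, `f(p + εβ) = f(p) + ε df_p(β)` over the dual numbers; it turns
tangent vectors into algebra homomorphisms. -/
theorem aeval_inl_add_inr (p β : σ → k) (f : MvPolynomial σ k) :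
    aeval (fun s => (TrivSqZeroExt.inl (p s) + TrivSqZeroExt.inr (β s) : TrivSqZeroExt k k)) f =
      TrivSqZeroExt.inl (eval p f) + TrivSqZeroExt.inr (dirDeriv p β f) := by
  induction f using MvPolynomial.induction_on with
  | C a => ext <;> simp [TrivSqZeroExt.algebraMap_eq_inl]
  | add f g hf hg =>
    rw [map_add, hf, hg]
    ext <;> simp
  | mul_X f s hf =>
    rw [map_mul, hf, aeval_X]
    ext <;> simp

/-- Both sides count `k`-valued derivations at `p`. Since `Ω` of the smooth localization is free of
rank `d`, these form a space of dimension `d`; and evaluating a derivation on the variables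
identifies them with tangent vectors. -/
theorem finrank_zariskiTangent {J : Ideal (MvPolynomial σ k)} {p : σ → k}
    (hp : ∀ f ∈ J, eval p f = 0) {f : MvPolynomial σ k} (hf : eval p f ≠ 0) {d : ℕ}
    (h : Algebra.IsStandardSmoothOfRelativeDimension d k
      (Localization.Away (Ideal.Quotient.mk J f))) :
    Module.finrank k (zariskiTangent J p) = d := by
  let R := MvPolynomial σ k ⧸ J
  let r : R := Ideal.Quotient.mk J f
  let S := Localization.Away r
  let ev₀ : R →ₐ[k] k := Ideal.Quotient.liftₐ J (aeval p) (fun g hg => hp g hg)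
  have hr : IsUnit (ev₀ r) := (isUnit_iff_ne_zero).2 hf
  let ev : S →ₐ[k] k := IsLocalization.liftAlgHom (M := Submonoid.powers r) (f := ev₀) (by
    rintro ⟨_, n, rfl⟩
    simpa using hr.pow n)
  let π : MvPolynomial σ k →ₐ[k] S :=
    (IsScalarTower.toAlgHom k R S).comp (Ideal.Quotient.mkₐ k J)
  have hev : ∀ g, ev (π g) = eval p g := fun g => by
    simp only [ev, π, AlgHom.comp_apply, IsScalarTower.coe_toAlgHom',
      IsLocalization.liftAlgHom_apply, IsLocalization.lift_eq]
    rfl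
  -- From here on `k` is an `S`-module through evaluation at `p`, so derivations `S → k` are point
  -- derivations.
  let : Algebra S k := ev.toRingHom.toAlgebra
  have : IsScalarTower k S k := IsScalarTower.of_algebraMap_eq fun c => (ev.commutes c).symm
  have hsmul : ∀ (g : MvPolynomial σ k) (x : k), π g • x = eval p g * x := fun g x => by
    rw [← hev]; rfl
  have : Nontrivial S := ev.toRingHom.domain_nontrivial
  have hfin : Module.finrank k (Derivation k S k) = d := by
    have : Algebra.IsStandardSmooth k S := h.isStandardSmooth
    have hrk := Algebra.IsStandardSmoothOfRelativeDimension.rank_kaehlerDifferential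
      (R := k) (S := S) d
    let b := Module.finBasisOfFinrankEq S (Ω[S⁄k]) (Module.finrank_eq_of_rank_eq hrk)
    let e : Derivation k S k ≃ₗ[k] (Fin d → k) :=
      ((KaehlerDifferential.linearMapEquivDerivation k S (M := k)).symm.restrictScalars k).trans
        ((b.constr k (M' := k)).symm)
    rw [e.finrank_eq, Module.finrank_fin_fun]
  have hD : ∀ (D : Derivation k S k) (g : MvPolynomial σ k),
      D (π g) = dirDeriv p (fun s => D (π (X s))) g := by
    intro D g
    induction g using MvPolynomial.induction_on with
    | C a =>
      have : π (C a) = algebraMap k S a := π.commutes a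
      rw [this]; simp
    | add f g hf hg => simp [hf, hg]
    | mul_X g s hg => simp [Derivation.leibniz, hg, hsmul, mul_comm]
  let Φ : Derivation k S k →ₗ[k] zariskiTangent J p :=
    { toFun := fun D => ⟨fun s => D (π (X s)), fun g hg => by
        refine (hD D g).symm.trans ?_
        have : π g = 0 := by
          change algebraMap R S (Ideal.Quotient.mk J g) = 0
          rw [Ideal.Quotient.eq_zero_iff_mem.2 hg, map_zero]
        rw [this, map_zero]⟩
      map_add' := fun _ _ => rfl
      map_smul' := fun _ _ => rfl }
  rw [← hfin]
  refine (LinearEquiv.ofBijective Φ ⟨?_, ?_⟩).finrank_eq.symm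
  · rw [injective_iff_map_eq_zero]
    intro D hDz
    have hπ : ∀ g, D (π g) = 0 := fun g => by
      have h0 : (fun s => D (π (X s))) = 0 := congr_arg Subtype.val hDz
      rw [hD, h0]
      simp [dirDeriv]
    ext x
    obtain ⟨⟨y, ⟨_, n, rfl⟩⟩, hx⟩ := IsLocalization.surj (Submonoid.powers r) x
    obtain ⟨g, rfl⟩ := Ideal.Quotient.mk_surjective y
    have h1 : x * π (f ^ n) = π g := by
      refine Eq.trans ?_ hx
      congr 1
    have h2 := congr_arg D h1
    rw [Derivation.leibniz, hπ, hπ, smul_zero, zero_add, hsmul, map_pow] at h2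
    exact (mul_eq_zero.1 h2).resolve_left (pow_ne_zero _ hf)
  · rintro ⟨β, hβ⟩
    -- A tangent vector gives a homomorphism to the dual numbers killing `J`. It extends to the
    -- localization because `f(p) ≠ 0`, and its `ε`-part is the required derivation.
    let φ : MvPolynomial σ k →ₐ[k] TrivSqZeroExt k k :=
      aeval (fun s => (TrivSqZeroExt.inl (p s) + TrivSqZeroExt.inr (β s) : TrivSqZeroExt k k))
    have hφ : ∀ g, φ g = _ := aeval_inl_add_inr p β
    let φ₁ : R →ₐ[k] TrivSqZeroExt k k := Ideal.Quotient.liftₐ J φ (fun g hg => by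
      rw [hφ, hp g hg, mem_zariskiTangent.1 hβ g hg]; simp)
    let φ₂ : S →ₐ[k] TrivSqZeroExt k k :=
      IsLocalization.liftAlgHom (M := Submonoid.powers r) (f := φ₁) (by
        rintro ⟨_, n, rfl⟩
        have : IsUnit (φ₁ r) := by
          rw [TrivSqZeroExt.isUnit_iff_isUnit_fst]
          change IsUnit (φ f).fst
          rw [hφ]
          simpa using hf
        simpa using this.pow n)
    have hφ₂ : ∀ g, φ₂ (π g) = φ g := fun g => by
      simp only [φ₂, π, AlgHom.comp_apply, IsScalarTower.coe_toAlgHom',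
        IsLocalization.liftAlgHom_apply, IsLocalization.lift_eq]
      rfl
    have hfst : ∀ x, (φ₂ x).fst = ev x := by
      have : (TrivSqZeroExt.fstHom k k k).comp φ₂ = ev := by
        apply IsLocalization.algHom_ext (Submonoid.powers r)
        apply Ideal.Quotient.algHom_ext
        ext s
        have h1 : (φ₂ (π (X s))).fst = ev (π (X s)) := by
          rw [hφ₂, hφ, hev]; simp
        exact h1
      exact fun x => DFunLike.congr_fun this x
    let D : Derivation k S k := Derivation.mk'
      ((TrivSqZeroExt.sndHom k k).comp φ₂.toLinearMap) (fun x y => by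
        change (φ₂ (x * y)).snd = ev x * (φ₂ y).snd + ev y * (φ₂ x).snd
        rw [map_mul, TrivSqZeroExt.snd_mul, hfst, hfst, op_smul_eq_smul]
        rfl)
    refine ⟨D, ?_⟩
    ext s
    change (φ₂ (π (X s))).snd = β s
    rw [hφ₂]
    simp [φ]

end ZariskiTangent

/-! ### Coordinates and dimensions of representation spaces. -/

section RepCoordinates

variable {V : Type u} {Q : Quiver.{w} V} {v : V → ℕ}

variable (Q v) in
/-- The linear coordinates on `Rep(Q, v)`. -/
def coordsEquiv : RepSpace Q v ℂ ≃ₗ[ℂ] (Coord Q v → ℂ) where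
  toFun := coords
  invFun c := fun i j a => Matrix.of fun k l => c ⟨i, j, a, k, l⟩
  map_add' _ _ := rfl
  map_smul' _ _ := rfl
  left_inv _ := rfl
  right_inv _ := rfl

variable [Fintype V] [∀ i j : V, Fintype (Q.Hom i j)]

instance : Module.Finite ℂ (RepSpace Q v ℂ) := Module.Finite.equiv (coordsEquiv Q v).symm

theorem finrank_repSpace_eq_card :
    Module.finrank ℂ (RepSpace Q v ℂ) = Fintype.card (Coord Q v) := by
  rw [(coordsEquiv Q v).finrank_eq, Module.finrank_fintype_fun_eq_card]

theorem finrank_repSpace :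
    Module.finrank ℂ (RepSpace Q v ℂ) =
      ∑ i : V, ∑ j : V, Fintype.card (Q.Hom i j) * (v j * v i) := by
  rw [finrank_repSpace_eq_card]
  simp [Fintype.card_sigma]

theorem finrank_lieV : Module.finrank ℂ (LieV v) = ∑ i : V, v i * v i := by
  rw [Module.finrank_pi_fintype]
  simp [Module.finrank_matrix]

end RepCoordinates

section MomentMap

variable {I : Type u} [Fintype I] {Q : Quiver.{w} I} [∀ i j : I, Fintype (Q.Hom i j)] {v : I → ℕ}

/-! ### Equations of the fiber and their differentials. -/

section MomentDifferential

/-- The differential of the moment map. -/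
def momentDiff (α β : DoubleRep Q v ℂ) : LieV v := fun i =>
  (∑ j : I, ∑ x : Q.Hom j i, (α j i (pos x) * β i j (rev x) + β j i (pos x) * α i j (rev x))) -
    ∑ j : I, ∑ x : Q.Hom i j, (α j i (rev x) * β i j (pos x) + β j i (rev x) * α i j (pos x))

theorem momentMap_apply {R : Type t} [CommRing R] (ρ : DoubleRep Q v R) (i : I)
    (k l : Fin (v i)) :
    momentMap ρ i k l =
      (∑ j : I, ∑ x : Q.Hom j i, ∑ m, ρ j i (pos x) k m * ρ i j (rev x) m l) -
        ∑ j : I, ∑ x : Q.Hom i j, ∑ m, ρ j i (rev x) k m * ρ i j (pos x) m l := by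
  simp only [momentMap, Matrix.sub_apply, Matrix.sum_apply, Matrix.mul_apply]

/-- `Tr(xy) = Tr(yx)` arrow by arrow. This is the linear dependence that makes one equation of the
fiber redundant. -/
theorem sum_trace_momentMap {R : Type t} [CommRing R] (ρ : DoubleRep Q v R) :
    ∑ i, (momentMap ρ i).trace = 0 := by
  simp only [momentMap, Matrix.trace_sub, Matrix.trace_sum, Finset.sum_sub_distrib]
  rw [Finset.sum_comm, sub_eq_zero]
  exact Finset.sum_congr rfl fun i _ => Finset.sum_congr rfl fun j _ =>
    Finset.sum_congr rfl fun x _ => Matrix.trace_mul_comm _ _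

variable (Q v) in
/-- The equations of the fiber of the moment map. -/
def fiberEq (lam : I → ℂ) (e : Σ i : I, Fin (v i) × Fin (v i)) :
    MvPolynomial (Coord (double Q) v) ℂ :=
  (momentMap (genericRep (double Q) v) e.1 -
    (MvPolynomial.C (lam e.1) : MvPolynomial (Coord (double Q) v) ℂ) • 1) e.2.1 e.2.2

theorem fiberIdeal_eq_span (lam : I → ℂ) :
    fiberIdeal Q v lam = Ideal.span (Set.range (fiberEq Q v lam)) := by
  rw [fiberIdeal]
  congr 1
  ext p
  constructor
  · rintro ⟨i, k, l, rfl⟩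
    exact ⟨⟨i, k, l⟩, rfl⟩
  · rintro ⟨⟨i, k, l⟩, rfl⟩
    exact ⟨i, k, l, rfl⟩

theorem eval_fiberEq (lam : I → ℂ) (α : DoubleRep Q v ℂ) (e : Σ i : I, Fin (v i) × Fin (v i)) :
    MvPolynomial.eval (coords α) (fiberEq Q v lam e) =
      (momentMap α e.1 - lam e.1 • (1 : Matrix (Fin (v e.1)) (Fin (v e.1)) ℂ)) e.2.1 e.2.2 := by
  have h1 : MvPolynomial.eval (coords α)
      (((MvPolynomial.C (lam e.1) : MvPolynomial (Coord (double Q) v) ℂ) •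
        (1 : Matrix (Fin (v e.1)) (Fin (v e.1)) _)) e.2.1 e.2.2) =
      (lam e.1 • (1 : Matrix (Fin (v e.1)) (Fin (v e.1)) ℂ)) e.2.1 e.2.2 := by
    simp only [Matrix.smul_apply, Matrix.one_apply, smul_eq_mul]
    split_ifs <;> simp
  rw [fiberEq, Matrix.sub_apply, map_sub, h1, Matrix.sub_apply]
  simp [momentMap_apply, genericRep, coords]

theorem dirDeriv_fiberEq (lam : I → ℂ) (α β : DoubleRep Q v ℂ)
    (e : Σ i : I, Fin (v i) × Fin (v i)) :
    dirDeriv (coords α) (coords β) (fiberEq Q v lam e) = momentDiff α β e.1 e.2.1 e.2.2 := by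
  have h1 : dirDeriv (coords α) (coords β)
      (((MvPolynomial.C (lam e.1) : MvPolynomial (Coord (double Q) v) ℂ) •
        (1 : Matrix (Fin (v e.1)) (Fin (v e.1)) _)) e.2.1 e.2.2) = 0 := by
    simp only [Matrix.smul_apply, Matrix.one_apply, smul_eq_mul]
    split_ifs <;> simp
  rw [fiberEq, Matrix.sub_apply, map_sub, h1, sub_zero, momentMap_apply, momentDiff]
  simp only [map_sub, map_sum, dirDeriv_mul, genericRep, Matrix.of_apply, dirDeriv_X,
    MvPolynomial.eval_X, coords, Matrix.sub_apply, Matrix.sum_apply, Matrix.add_apply,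
    Matrix.mul_apply, Finset.sum_add_distrib]

theorem mem_fiber_iff {lam : I → ℂ} {α : DoubleRep Q v ℂ} :
    α ∈ fiber Q v lam ↔ ∀ f ∈ fiberIdeal Q v lam, MvPolynomial.eval (coords α) f = 0 := by
  have : (∀ f ∈ fiberIdeal Q v lam, MvPolynomial.eval (coords α) f = 0) ↔
      fiberIdeal Q v lam ≤ RingHom.ker (MvPolynomial.eval (coords α)) := Iff.rfl
  rw [this, fiberIdeal_eq_span, Ideal.span_le, Set.range_subset_iff]
  simp only [SetLike.mem_coe, RingHom.mem_ker, eval_fiberEq]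
  constructor
  · intro h e
    rw [h e.1, sub_self, Matrix.zero_apply]
  · intro h i
    rw [← sub_eq_zero]
    ext k l
    exact h ⟨i, k, l⟩

theorem coords_mem_zariskiTangent {lam : I → ℂ} {α β : DoubleRep Q v ℂ} :
    coords β ∈ zariskiTangent (fiberIdeal Q v lam) (coords α) ↔ β ∈ tangentSpace lam α := Iff.rfl

/-- By the Leibniz rule, generators of the ideal suffice: the terms in which the multiplier is
differentiated disappear because the generators vanish at a point of the fiber. -/
theorem mem_tangentSpace_iff {lam : I → ℂ} {α β : DoubleRep Q v ℂ} (hα : α ∈ fiber Q v lam) :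
    β ∈ tangentSpace lam α ↔ momentDiff α β = 0 := by
  rw [← coords_mem_zariskiTangent, mem_zariskiTangent]
  constructor
  · intro h
    funext i
    ext k l
    rw [← dirDeriv_fiberEq lam α β ⟨i, k, l⟩]
    refine h _ ?_
    rw [fiberIdeal_eq_span]
    exact Ideal.subset_span ⟨_, rfl⟩
  · intro h f hf
    have hf' := hf
    rw [fiberIdeal_eq_span] at hf'
    induction hf' using Submodule.span_induction with
    | mem f hf' =>
      obtain ⟨e, rfl⟩ := hf'
      rw [dirDeriv_fiberEq, h]
      rfl
    | zero => exact map_zero _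
    | add f g hf' hg' ihf ihg =>
      rw [← Ideal.span, ← fiberIdeal_eq_span] at hf' hg'
      rw [map_add, ihf hf', ihg hg', add_zero]
    | smul a f hf' ih =>
      rw [← Ideal.span, ← fiberIdeal_eq_span] at hf'
      rw [smul_eq_mul, dirDeriv_mul, ih hf', mem_fiber_iff.1 hα f hf']
      simp

end MomentDifferential

/-! ### The symplectic form and the moment map identity. -/

section Symplectic

theorem omega_apply (β γ : DoubleRep Q v ℂ) :
    omega Q v β γ = ∑ i : I, ∑ j : I, ∑ x : Q.Hom i j,
      ((γ j i (rev x) * β i j (pos x)).trace - (β j i (rev x) * γ i j (pos x)).trace) := rfl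

theorem omega_isAlt : (omega Q v).IsAlt := fun β => by
  rw [omega_apply]
  simp

theorem omega_separatingLeft {β : DoubleRep Q v ℂ} (h : ∀ γ, omega Q v β γ = 0) : β = 0 := by
  open ComplexOrder in
  -- Pairing `(x, y)` with `(-yᴴ, xᴴ)` gives the sum of `Tr(xᴴ x) + Tr(y yᴴ)`, which vanishes only
  -- if every component does.
  let γ : DoubleRep Q v ℂ := fun i j a =>
    Sum.casesOn (motive := fun _ => Matrix (Fin (v j)) (Fin (v i)) ℂ) a
      (fun x => -(β j i (rev x))ᴴ) (fun x => (β j i (pos x))ᴴ)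
  have h0 := h γ
  rw [omega_apply] at h0
  have hnn : ∀ (i j : I) (x : Q.Hom i j),
      0 ≤ ((β i j (pos x))ᴴ * β i j (pos x)).trace ∧
        0 ≤ (β j i (rev x) * (β j i (rev x))ᴴ).trace := fun i j x =>
    ⟨(Matrix.posSemidef_conjTranspose_mul_self _).trace_nonneg,
      (Matrix.posSemidef_self_mul_conjTranspose _).trace_nonneg⟩
  have h1 : ∀ (i j : I) (x : Q.Hom i j),
      ((γ j i (rev x) * β i j (pos x)).trace - (β j i (rev x) * γ i j (pos x)).trace) =
      ((β i j (pos x))ᴴ * β i j (pos x)).trace + (β j i (rev x) * (β j i (rev x))ᴴ).trace := by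
    intro i j x
    simp [γ]
  simp only [h1] at h0
  have h2 : ∀ (i j : I) (x : Q.Hom i j),
      ((β i j (pos x))ᴴ * β i j (pos x)).trace +
        (β j i (rev x) * (β j i (rev x))ᴴ).trace = 0 := by
    intro i j x
    have hs : ∀ (i j : I) (x : Q.Hom i j), 0 ≤ ((β i j (pos x))ᴴ * β i j (pos x)).trace +
        (β j i (rev x) * (β j i (rev x))ᴴ).trace :=
      fun i j x => add_nonneg (hnn i j x).1 (hnn i j x).2
    have h3 := (Finset.sum_eq_zero_iff_of_nonneg fun i _ => Finset.sum_nonneg fun j _ =>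
      Finset.sum_nonneg fun x _ => hs i j x).1 h0 i (Finset.mem_univ _)
    have h4 := (Finset.sum_eq_zero_iff_of_nonneg fun j _ =>
      Finset.sum_nonneg fun x _ => hs i j x).1 h3 j (Finset.mem_univ _)
    exact (Finset.sum_eq_zero_iff_of_nonneg fun x _ => hs i j x).1 h4 x (Finset.mem_univ _)
  funext i j a
  rcases a with x | x
  · have := (add_eq_zero_iff_of_nonneg (hnn i j x).1 (hnn i j x).2).1 (h2 i j x)
    exact Matrix.trace_conjTranspose_mul_self_eq_zero_iff.1 this.1
  · have := (add_eq_zero_iff_of_nonneg (hnn j i x).1 (hnn j i x).2).1 (h2 j i x)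
    exact Matrix.trace_mul_conjTranspose_self_eq_zero_iff.1 this.2

theorem omega_nondegenerate : (omega Q v).Nondegenerate := by
  refine ⟨fun β h => omega_separatingLeft h, fun β h => omega_separatingLeft fun γ => ?_⟩
  rw [← omega_isAlt.neg_eq, h, neg_zero]

/-- The moment map identity `ω(u α, β) = ⟨u, dμ_α(β)⟩`. -/
theorem omega_infinitesimalAction (α β : DoubleRep Q v ℂ) (u : LieV v) :
    omega Q v (infinitesimalAction α u) β = ∑ i, (u i * momentDiff α β i).trace := by
  rw [omega_apply]
  simp only [momentDiff, Matrix.mul_sub, Matrix.mul_sum, Matrix.trace_sub, Matrix.trace_sum,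
    Finset.sum_sub_distrib]
  rw [Finset.sum_comm (γ := I) (f := fun i j => ∑ x : Q.Hom j i, _)]
  simp only [← Finset.sum_sub_distrib]
  refine Finset.sum_congr rfl fun i _ => Finset.sum_congr rfl fun j _ =>
    Finset.sum_congr rfl fun x _ => ?_
  change (β j i (rev x) * (u j * α i j (pos x) - α i j (pos x) * u i)).trace -
    ((u i * α j i (rev x) - α j i (rev x) * u j) * β i j (pos x)).trace = _
  have h1 : (β j i (rev x) * (u j * α i j (pos x))).trace =
      (u j * (α i j (pos x) * β j i (rev x))).trace := by
    rw [Matrix.trace_mul_comm, Matrix.mul_assoc]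
  have h2 : (β j i (rev x) * (α i j (pos x) * u i)).trace =
      (u i * (β j i (rev x) * α i j (pos x))).trace := by
    rw [← Matrix.mul_assoc, Matrix.trace_mul_comm]
  have h3 : (α j i (rev x) * (u j * β i j (pos x))).trace =
      (u j * (β i j (pos x) * α j i (rev x))).trace := by
    rw [Matrix.trace_mul_comm, Matrix.mul_assoc]
  simp only [Matrix.mul_sub, Matrix.sub_mul, Matrix.mul_add, Matrix.trace_sub, Matrix.trace_add,
    h1, h2, Matrix.mul_assoc, h3]
  ring

/-- The moment map identity together with nondegeneracy of the trace pairing, tested one vertex at a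
time. -/
theorem tangentSpace_eq_orthogonal {lam : I → ℂ} {α : DoubleRep Q v ℂ} (hα : α ∈ fiber Q v lam) :
    tangentSpace lam α = (omega Q v).orthogonal (orbitTangent α) := by
  classical
  ext β
  rw [mem_tangentSpace_iff hα, LinearMap.BilinForm.mem_orthogonal_iff]
  constructor
  · rintro h _ ⟨u, rfl⟩
    change omega Q v _ _ = 0
    simp [omega_infinitesimalAction, h]
  · intro h
    funext i
    apply Matrix.ext_iff_trace_mul_left.2
    intro A
    have h1 : omega Q v (infinitesimalAction α (Pi.single i A)) β = 0 := h _ ⟨_, rfl⟩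
    rw [omega_infinitesimalAction, Finset.sum_eq_single i] at h1
    · simpa using h1
    · intro j _ hj
      simp [Pi.single_eq_of_ne hj]
    · simp

theorem finrank_tangentSpace {lam : I → ℂ} {α : DoubleRep Q v ℂ} (hα : α ∈ fiber Q v lam) :
    (Module.finrank ℂ (tangentSpace lam α) : ℤ) = Module.finrank ℂ (DoubleRep Q v ℂ) -
      Module.finrank ℂ (orbitTangent α) := by
  rw [tangentSpace_eq_orthogonal hα, LinearMap.BilinForm.finrank_orthogonal omega_nondegenerate,
    Nat.cast_sub (Submodule.finrank_le _)]

omit [∀ i j : I, Fintype (Q.Hom i j)] in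
theorem finrank_orbitTangent (α : DoubleRep Q v ℂ) :
    (Module.finrank ℂ (orbitTangent α) : ℤ) = Module.finrank ℂ (LieV v) -
      Module.finrank ℂ (LinearMap.ker (infinitesimalAction α)) := by
  rw [orbitTangent, ← LinearMap.finrank_range_add_finrank_ker (infinitesimalAction α)]
  push_cast
  ring

end Symplectic

/-! ### The smooth locus as the locus of scalar stabilizer. -/

section SmoothLocus

/-- Only the scalars annihilate `ρ` under the infinitesimal action. -/
def HasScalarStabilizer {V : Type u} {Q : Quiver.{w} V} {v : V → ℕ} (ρ : RepSpace Q v ℂ) : Prop :=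
  ∀ u : LieV v, infinitesimalAction ρ u = 0 → ∃ c : ℂ, ∀ i, u i = c • 1

theorem infinitesimalAction_one {V : Type u} {Q : Quiver.{w} V} {v : V → ℕ}
    (ρ : RepSpace Q v ℂ) : infinitesimalAction ρ (fun _ => 1) = 0 := by
  funext i j a
  change (1 : Matrix (Fin (v j)) (Fin (v j)) ℂ) * ρ i j a -
    ρ i j a * (1 : Matrix (Fin (v i)) (Fin (v i)) ℂ) = 0
  rw [Matrix.one_mul, Matrix.mul_one, sub_self]

theorem hasScalarStabilizer_iff {V : Type u} [Fintype V] {Q : Quiver.{w} V} {v : V → ℕ}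
    (hv : v ≠ 0) (ρ : RepSpace Q v ℂ) :
    HasScalarStabilizer ρ ↔
      Module.finrank ℂ (LinearMap.ker (infinitesimalAction ρ)) = 1 := by
  obtain ⟨i₀, hi₀⟩ := Function.ne_iff.1 hv
  have : NeZero (v i₀) := ⟨hi₀⟩
  let e : LinearMap.ker (infinitesimalAction ρ) := ⟨fun _ => 1, infinitesimalAction_one ρ⟩
  -- Here `v ≠ 0` is essential: otherwise the identity tuple would be zero and span no line.
  have he : e ≠ 0 := fun h => by
    have h1 := congr_fun (congr_arg Subtype.val h) i₀
    exact one_ne_zero h1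
  rw [finrank_eq_one_iff_of_nonzero' e he]
  constructor
  · rintro h ⟨u, hu⟩
    obtain ⟨c, hc⟩ := h u hu
    exact ⟨c, Subtype.ext (funext fun i => (hc i).symm)⟩
  · intro h u hu
    obtain ⟨c, hc⟩ := h ⟨u, hu⟩
    exact ⟨c, fun i => (congr_fun (congr_arg Subtype.val hc) i).symm⟩

/-- The entries of `⊕ gl(v_i)` other than a fixed one. -/
abbrev EntryExcept (e₀ : Σ i : I, Fin (v i) × Fin (v i)) :=
  {e : Σ i : I, Fin (v i) × Fin (v i) // e ≠ e₀}

/-- A point in the fiber forces `∑ λ_i v_i = 0` by taking traces, so the constant terms of the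
diagonal equations cancel along with the traces of `μ`. -/
theorem sum_fiberEq_diag {lam : I → ℂ} {α : DoubleRep Q v ℂ} (hα : α ∈ fiber Q v lam) :
    ∑ e : Σ i : I, Fin (v i), fiberEq Q v lam ⟨e.1, e.2, e.2⟩ = 0 := by
  have h1 : ∑ i, lam i * (v i : ℂ) = 0 := by
    rw [← sum_trace_momentMap α]
    refine Finset.sum_congr rfl fun i _ => ?_
    rw [hα i, Matrix.trace_smul, Matrix.trace_one]
    simp
  rw [Fintype.sum_sigma]
  have h2 : ∀ i, ∑ k, fiberEq Q v lam ⟨i, k, k⟩ =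
      (momentMap (genericRep (double Q) v) i).trace - MvPolynomial.C (lam i * (v i : ℂ)) := by
    intro i
    change (momentMap (genericRep (double Q) v) i -
      (MvPolynomial.C (lam i) : MvPolynomial (Coord (double Q) v) ℂ) • 1).trace = _
    rw [Matrix.trace_sub, Matrix.trace_smul, Matrix.trace_one]
    simp
  simp only [h2]
  rw [Finset.sum_sub_distrib, sum_trace_momentMap, ← map_sum, h1, map_zero, sub_zero]

theorem fiberIdeal_eq_span_except {lam : I → ℂ} {α : DoubleRep Q v ℂ} (hα : α ∈ fiber Q v lam)
    (i₀ : I) (k₀ : Fin (v i₀)) :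
    fiberIdeal Q v lam = Ideal.span (Set.range
      fun e : EntryExcept (v := v) ⟨i₀, k₀, k₀⟩ => fiberEq Q v lam e.1) := by
  classical
  rw [fiberIdeal_eq_span]
  apply le_antisymm
  · rw [Ideal.span_le]
    rintro _ ⟨e, rfl⟩
    by_cases he : e = ⟨i₀, k₀, k₀⟩
    · have h := sum_fiberEq_diag hα
      rw [← Finset.add_sum_erase _ _ (Finset.mem_univ (⟨i₀, k₀⟩ : Σ i : I, Fin (v i))),
        add_eq_zero_iff_eq_neg] at h
      subst he
      rw [h, SetLike.mem_coe, neg_mem_iff]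
      refine Ideal.sum_mem _ fun e he => Ideal.subset_span ⟨⟨⟨e.1, e.2, e.2⟩, fun h => ?_⟩, rfl⟩
      refine Finset.ne_of_mem_erase he ?_
      obtain ⟨i, k⟩ := e
      simp only [Sigma.mk.injEq] at h
      obtain ⟨rfl, h⟩ := h
      rw [heq_eq_eq, Prod.mk.injEq] at h
      rw [h.1]
    · exact Ideal.subset_span ⟨⟨e, he⟩, rfl⟩
  · exact Ideal.span_mono (by rintro _ ⟨e, rfl⟩; exact ⟨e.1, rfl⟩)

/-- A relation among the differentials is a tuple `u` with `ω(uα, ·) = 0`, so `uα = 0` and `u` is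
scalar. Its entry at the omitted position is zero, so `u = 0`. -/
theorem linearIndependent_differentials {lam : I → ℂ} {α : DoubleRep Q v ℂ}
    (hs : HasScalarStabilizer α) (i₀ : I) (k₀ : Fin (v i₀)) :
    LinearIndependent ℂ fun e : EntryExcept (v := v) ⟨i₀, k₀, k₀⟩ => fun s =>
      MvPolynomial.eval (coords α) (MvPolynomial.pderiv s (fiberEq Q v lam e.1)) := by
  classical
  rw [Fintype.linearIndependent_iff]
  intro c hc
  -- The indices are transposed since `Tr(uA)` pairs the entry `(l, k)` of `u` with the entry `(k,
  -- l)` of `A`.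
  let u : LieV v := fun i => Matrix.of fun l k =>
    if h : (⟨i, k, l⟩ : Σ i : I, Fin (v i) × Fin (v i)) ≠ ⟨i₀, k₀, k₀⟩ then c ⟨_, h⟩ else 0
  have hu : infinitesimalAction α u = 0 := by
    refine omega_separatingLeft fun β => ?_
    rw [omega_infinitesimalAction]
    have h1 : ∑ e, c e * dirDeriv (coords α) (coords β) (fiberEq Q v lam e.1) = 0 := by
      have h2 := congr_arg (fun φ : Coord (double Q) v → ℂ => φ ⬝ᵥ coords β) hc
      simp only [zero_dotProduct, sum_dotProduct, smul_dotProduct, smul_eq_mul] at h2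
      exact h2
    refine Eq.trans ?_ h1
    have h3 : ∀ i, (u i * momentDiff α β i).trace =
        ∑ e : Fin (v i) × Fin (v i), u i e.2 e.1 * momentDiff α β i e.1 e.2 := by
      intro i
      rw [Fintype.sum_prod_type, Finset.sum_comm]
      simp [Matrix.trace, Matrix.mul_apply]
    simp only [h3]
    rw [← Fintype.sum_sigma (fun e : Σ i : I, Fin (v i) × Fin (v i) =>
      u e.1 e.2.2 e.2.1 * momentDiff α β e.1 e.2.1 e.2.2),
      ← Finset.sum_erase (a := (⟨i₀, k₀, k₀⟩ : Σ i : I, Fin (v i) × Fin (v i))) _ (by simp [u]),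
      Finset.sum_subtype (p := fun e => e ≠ ⟨i₀, k₀, k₀⟩) _ (by simp)]
    refine Finset.sum_congr rfl fun e _ => ?_
    rw [dirDeriv_fiberEq]
    congr 1
    exact dif_pos e.2
  obtain ⟨a, ha⟩ := hs u hu
  have ha0 : a = 0 := by
    have := congr_fun (congr_fun (ha i₀) k₀) k₀
    simpa [u] using this.symm
  rintro ⟨⟨i, k, l⟩, he⟩
  have := congr_fun (congr_fun (ha i) l) k
  rw [ha0, zero_smul] at this
  exact (dif_pos he).symm.trans this

theorem card_entryExcept (e₀ : Σ i : I, Fin (v i) × Fin (v i)) :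
    Nat.card (EntryExcept (v := v) e₀) + 1 = Module.finrank ℂ (LieV v) := by
  classical
  rw [Nat.card_eq_fintype_card, finrank_lieV]
  have := Fintype.card_subtype_compl (fun e => e = e₀)
  have h2 : Fintype.card (Σ i : I, Fin (v i) × Fin (v i)) = ∑ i, v i * v i := by
    simp [Fintype.card_sigma]
  have h3 : 0 < Fintype.card (Σ i : I, Fin (v i) × Fin (v i)) := Fintype.card_pos_iff.2 ⟨e₀⟩
  rw [Fintype.card_subtype_eq] at this
  change Fintype.card {e // ¬ e = e₀} + 1 = _
  omega

theorem mem_smoothLocus_iff (hv : v ≠ 0) {lam : I → ℂ} {α : DoubleRep Q v ℂ} :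
    α ∈ smoothLocus Q v lam ↔ α ∈ fiber Q v lam ∧ HasScalarStabilizer α := by
  constructor
  · rintro ⟨d, hd, hα, f, hf, hsm⟩
    refine ⟨hα, ?_⟩
    have h1 := finrank_zariskiTangent (mem_fiber_iff.1 hα) hf hsm
    have h2 : Module.finrank ℂ (tangentSpace lam α) =
        Module.finrank ℂ (zariskiTangent (fiberIdeal Q v lam) (coords α)) :=
      ((coordsEquiv (double Q) v).submoduleMap (tangentSpace lam α)).finrank_eq.trans
        (congr_arg (fun S : Submodule ℂ (Coord (double Q) v → ℂ) => Module.finrank ℂ S)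
          (Submodule.map_equiv_eq_comap_symm _ _))
    have h3 := finrank_tangentSpace hα
    have h4 := finrank_orbitTangent α
    rw [hasScalarStabilizer_iff hv]
    omega
  · classical
    rintro ⟨hα, hs⟩
    obtain ⟨i₀, hi₀⟩ := Function.ne_iff.1 hv
    let k₀ : Fin (v i₀) := ⟨0, Nat.pos_of_ne_zero hi₀⟩
    have hli := linearIndependent_differentials (lam := lam) hs i₀ k₀
    obtain ⟨f, hf, hsm⟩ := exists_isStandardSmooth_away _ _ hli
      (fiberIdeal_eq_span_except hα i₀ k₀)
    refine ⟨_, ?_, hα, f, hf, hsm⟩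
    -- The relative dimension is a truncated natural subtraction; independence shows that there are
    -- at most as many equations as coordinates.
    have h1 := hli.fintype_card_le_finrank
    have h2 := card_entryExcept (v := v) ⟨i₀, k₀, k₀⟩
    have h3 := finrank_repSpace_eq_card (Q := double Q) (v := v)
    rw [Module.finrank_fintype_fun_eq_card] at h1
    rw [Nat.card_eq_fintype_card] at h2 ⊢
    rw [Nat.card_eq_fintype_card]
    change (_ : ℤ) = (Module.finrank ℂ (RepSpace (double Q) v ℂ) : ℤ) - _
    omega

end SmoothLocus

/-! ### Stability and freeness of the group action. -/

section GroupAction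

theorem smul_apply {V : Type u} {Q : Quiver.{w} V} {v : V → ℕ} (g : GroupV v)
    (ρ : RepSpace Q v ℂ) {i j : V} (a : Q.Hom i j) :
    (g • ρ) i j a = (g j : Matrix (Fin (v j)) (Fin (v j)) ℂ) * ρ i j a *
      ((g i)⁻¹ : GL (Fin (v i)) ℂ).val := rfl

theorem infinitesimalAction_apply {V : Type u} {Q : Quiver.{w} V} {v : V → ℕ}
    (ρ : RepSpace Q v ℂ) (u : LieV v) {i j : V} (a : Q.Hom i j) :
    infinitesimalAction ρ u i j a = u j * ρ i j a - ρ i j a * u i := rfl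

theorem inv_mul_cancel_left_matrix {m n : ℕ} (g : GL (Fin m) ℂ) (A : Matrix (Fin m) (Fin n) ℂ) :
    (g⁻¹ : GL (Fin m) ℂ).val * (g.val * A) = A := by
  rw [← Matrix.mul_assoc, ← Units.val_mul, inv_mul_cancel, Units.val_one, Matrix.one_mul]

theorem mul_inv_cancel_left_matrix {m n : ℕ} (g : GL (Fin m) ℂ) (A : Matrix (Fin m) (Fin n) ℂ) :
    g.val * ((g⁻¹ : GL (Fin m) ℂ).val * A) = A := by
  rw [← Matrix.mul_assoc, ← Units.val_mul, mul_inv_cancel, Units.val_one, Matrix.one_mul]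

theorem momentMap_smul (g : GroupV v) (α : DoubleRep Q v ℂ) (i : I) :
    momentMap (g • α) i = (g i).val * momentMap α i * ((g i)⁻¹ : GL (Fin (v i)) ℂ).val := by
  simp only [momentMap, smul_apply, Matrix.mul_sub, Matrix.sub_mul, Matrix.mul_sum, Matrix.sum_mul,
    Matrix.mul_assoc, inv_mul_cancel_left_matrix]

theorem smul_mem_fiber {lam : I → ℂ} {α : DoubleRep Q v ℂ} (hα : α ∈ fiber Q v lam)
    (g : GroupV v) : g • α ∈ fiber Q v lam := fun i => by
  rw [momentMap_smul, hα i, Matrix.mul_smul, Matrix.smul_mul, Matrix.mul_one, ← Units.val_mul,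
    mul_inv_cancel, Units.val_one]

theorem HasScalarStabilizer.smul {V : Type u} {Q : Quiver.{w} V} {v : V → ℕ} {ρ : RepSpace Q v ℂ}
    (hρ : HasScalarStabilizer ρ) (g : GroupV v) : HasScalarStabilizer (g • ρ) := by
  intro u hu
  obtain ⟨c, hc⟩ := hρ (fun i => ((g i)⁻¹ : GL (Fin (v i)) ℂ).val * u i * (g i).val) (by
    funext i j a
    have h1 := congr_fun (congr_fun (congr_fun hu i) j) a
    rw [infinitesimalAction_apply, smul_apply] at h1
    have h2 := congr_arg
      (fun A => ((g j)⁻¹ : GL (Fin (v j)) ℂ).val * A * (g i).val) (sub_eq_zero.1 h1)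
    rw [infinitesimalAction_apply]
    refine sub_eq_zero.2 ?_
    simpa only [Matrix.mul_assoc, inv_mul_cancel_left_matrix, ← Units.val_mul, inv_mul_cancel,
      Units.val_one, Matrix.mul_one] using h2)
  refine ⟨c, fun i => ?_⟩
  have h1 := congr_arg (fun A => (g i).val * A * ((g i)⁻¹ : GL (Fin (v i)) ℂ).val) (hc i)
  simpa only [Matrix.mul_assoc, mul_inv_cancel_left_matrix, ← Units.val_mul, mul_inv_cancel,
    Units.val_one, Matrix.mul_one, Matrix.one_mul, Matrix.smul_mul, Matrix.mul_smul] using h1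

/-- The condition `gρ = ρ` says `g_j ρ_a = ρ_a g_i`, which is linear in `g`: the invertible tuple
`g` itself lies in the kernel of the infinitesimal action. -/
theorem stabilizer_eq_bot {V : Type u} {Q : Quiver.{w} V} {v : V → ℕ} (hv : v ≠ 0)
    {ρ : RepSpace Q v ℂ} (hρ : HasScalarStabilizer ρ) :
    MulAction.stabilizer (GroupV v ⧸ scalars v) ρ = ⊥ := by
  obtain ⟨i₀, hi₀⟩ := Function.ne_iff.1 hv
  have : NeZero (v i₀) := ⟨hi₀⟩
  rw [eq_bot_iff]
  intro q hq
  induction q using QuotientGroup.induction_on with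
  | H g =>
    have hg : g • ρ = ρ := hq
    obtain ⟨c, hc⟩ := hρ (fun i => (g i).val) (by
      funext i j a
      have h1 := congr_fun (congr_fun (congr_fun hg i) j) a
      have h2 := congr_arg (fun A => A * (g i).val) h1
      rw [infinitesimalAction_apply]
      refine sub_eq_zero.2 ?_
      simpa only [smul_apply, Matrix.mul_assoc, ← Units.val_mul, inv_mul_cancel, Units.val_one,
        Matrix.mul_one] using h2)
    have hc0 : c ≠ 0 := by
      rintro rfl
      have := hc i₀
      rw [zero_smul] at this
      exact (g i₀).ne_zero this
    rw [Subgroup.mem_bot, QuotientGroup.eq_one_iff]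
    refine ⟨Units.mk0 c hc0, ?_⟩
    funext i
    apply Units.ext
    change Matrix.scalar (Fin (v i)) c = (g i).val
    rw [hc i, Matrix.scalar_apply, Matrix.smul_one_eq_diagonal]

end GroupAction

/-! ### Linear symplectic reduction and the dimension of the normal space. -/

section NormalSpace

/-- A nondegenerate alternating form descends to a symplectic form on the quotient of the
orthogonal `W` of an isotropic subspace `O` by `O`. -/
theorem existsUnique_symplectic_quotient {K V : Type*} [Field K] [AddCommGroup V] [Module K V]
    [FiniteDimensional K V] {B : LinearMap.BilinForm K V} (hB : B.Nondegenerate) (hA : B.IsAlt)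
    {O W : Submodule K V} (hW : W = B.orthogonal O) :
    ∃! ω : LinearMap.BilinForm K (W ⧸ O.comap W.subtype),
      (∀ β γ : W, ω (Submodule.Quotient.mk β) (Submodule.Quotient.mk γ) = B (β : V) (γ : V)) ∧
      ω.IsAlt ∧ ω.Nondegenerate := by
  have hl : ∀ β ∈ O, ∀ γ ∈ W, B β γ = 0 := fun β hβ γ hγ => by
    rw [hW] at hγ
    exact hγ β hβ
  have hr : ∀ β ∈ W, ∀ γ ∈ O, B β γ = 0 := fun β hβ γ hγ => by
    rw [← hA.neg_eq, hl γ hγ β hβ, neg_zero]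
  let N := O.comap W.subtype
  let f : W →ₗ[K] (W ⧸ N) →ₗ[K] K :=
    { toFun := fun β => N.liftQ ((B β).comp W.subtype) fun γ hγ => hr β β.2 γ hγ
      map_add' := fun β β' => by ext γ; exact LinearMap.map_add₂ B (β : V) β' γ
      map_smul' := fun c β => by ext γ; exact LinearMap.map_smul₂ B c (β : V) γ }
  let ω : LinearMap.BilinForm K (W ⧸ N) := N.liftQ f fun β hβ => by
    ext γ
    exact hl β hβ γ γ.2
  have hω : ∀ β γ : W, ω (Submodule.Quotient.mk β) (Submodule.Quotient.mk γ) = B (β : V) (γ : V) :=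
    fun β γ => rfl
  have hωA : ω.IsAlt := fun x => by
    induction x using Submodule.Quotient.induction_on with
    | H β => rw [hω]; exact hA β
  have hsep : ∀ x, (∀ y, ω x y = 0) → x = 0 := fun x hx => by
    induction x using Submodule.Quotient.induction_on with
    | H β =>
      rw [Submodule.Quotient.mk_eq_zero]
      change (β : V) ∈ O
      -- The radical of the restriction to `W = O^⊥` is contained in `W^⊥ = O^⊥⊥ = O`, which is what
      -- the quotient kills.
      rw [← LinearMap.BilinForm.orthogonal_orthogonal hB hA.isRefl O, ← hW,
        LinearMap.BilinForm.mem_orthogonal_iff]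
      intro γ hγ
      change B γ β = 0
      rw [← hA.neg_eq, ← hω β ⟨γ, hγ⟩, hx, neg_zero]
  refine ⟨ω, ⟨hω, hωA, hsep, fun y hy => hsep y fun x => ?_⟩, ?_⟩
  · rw [← hωA.neg_eq, hy, neg_zero]
  · rintro ω' ⟨h', -, -⟩
    ext x y
    exact h' x y

/-- Infinitesimal equivariance, `dμ_α(uα) = [u, μ(α)]`. Over a central value the commutator
vanishes, so the orbit is tangent to the fiber. -/
theorem momentDiff_infinitesimalAction (α : DoubleRep Q v ℂ) (u : LieV v) (i : I) :
    momentDiff α (infinitesimalAction α u) i = u i * momentMap α i - momentMap α i * u i := by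
  have h1 : ∀ (i j : I) (x : (double Q).Hom j i) (y : (double Q).Hom i j),
      α j i x * (u j * α i j y - α i j y * u i) + (u i * α j i x - α j i x * u j) * α i j y =
        u i * (α j i x * α i j y) - α j i x * α i j y * u i := by
    intro i j x y
    simp only [Matrix.mul_sub, Matrix.sub_mul, Matrix.mul_assoc]
    abel
  simp only [momentDiff, infinitesimalAction_apply, h1]
  simp only [momentMap, Matrix.mul_sub, Matrix.sub_mul,
    Matrix.mul_sum, Matrix.sum_mul, Finset.sum_sub_distrib]
  abel

theorem orbitTangent_le_tangentSpace {lam : I → ℂ} {α : DoubleRep Q v ℂ}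
    (hα : α ∈ fiber Q v lam) : orbitTangent α ≤ tangentSpace lam α := by
  rintro _ ⟨u, rfl⟩
  rw [mem_tangentSpace_iff hα]
  funext i
  rw [momentDiff_infinitesimalAction, hα i]
  simp

theorem cartan_mulVec_dotProduct [DecidableEq I] :
    (cartan Q *ᵥ fun i => (v i : ℤ)) ⬝ᵥ (fun i => (v i : ℤ)) =
      2 * Module.finrank ℂ (LieV v) - Module.finrank ℂ (DoubleRep Q v ℂ) := by
  rw [finrank_lieV, finrank_repSpace, Finset.sum_comm, cartan, Matrix.sub_mulVec,
    sub_dotProduct, Matrix.smul_mulVec, Matrix.one_mulVec]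
  congr 1
  · simp [dotProduct, Finset.mul_sum, mul_assoc]
  · simp only [dotProduct, Matrix.mulVec, adjacency, Matrix.of_apply]
    push_cast
    refine Finset.sum_congr rfl fun i _ => ?_
    rw [Finset.sum_mul]
    refine Finset.sum_congr rfl fun j _ => ?_
    ring

theorem finrank_normalSpace [DecidableEq I] (hv : v ≠ 0) {lam : I → ℂ} {α : DoubleRep Q v ℂ}
    (hα : α ∈ smoothLocus Q v lam) :
    (Module.finrank ℂ (NormalSpace lam α) : ℤ) =
      2 - (cartan Q *ᵥ fun i => (v i : ℤ)) ⬝ᵥ fun i => (v i : ℤ) := by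
  obtain ⟨hf, hs⟩ := (mem_smoothLocus_iff hv).1 hα
  have h1 := (hasScalarStabilizer_iff hv α).1 hs
  have h2 := finrank_tangentSpace hf
  have h3 := finrank_orbitTangent α
  have h4 : Module.finrank ℂ (NormalSpace lam α) + Module.finrank ℂ (orbitTangent α) =
      Module.finrank ℂ (tangentSpace lam α) := by
    rw [← (Submodule.comapSubtypeEquivOfLe (orbitTangent_le_tangentSpace hf)).finrank_eq]
    exact Submodule.finrank_quotient_add_finrank _
  rw [cartan_mulVec_dotProduct]
  omega

end NormalSpace

end MomentMap

/-! ### Relations and generators of the preprojective algebra. -/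

section PreprojectiveRelations

variable {I : Type u} [Fintype I] {Q : Quiver.{w} I} [∀ i j : I, Fintype (Q.Hom i j)]

variable (Q) in
/-- The projection of the free algebra onto `Π_λ`. -/
def preMk (lam : I → ℂ) : FreeAlgebra ℂ (PathGen (double Q)) →ₐ[ℂ] Preproj Q lam :=
  (RingQuot.mkAlgHom ℂ (PreprojRel Q lam)).comp (RingQuot.mkAlgHom ℂ (PathRel (double Q)))

theorem preMk_rel (lam : I → ℂ) {a b : FreeAlgebra ℂ (PathGen (double Q))}
    (h : PathRel (double Q) a b) : preMk Q lam a = preMk Q lam b := by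
  rw [preMk, AlgHom.comp_apply, AlgHom.comp_apply, RingQuot.mkAlgHom_rel ℂ h]

theorem preMk_vertex (lam : I → ℂ) (i : I) :
    preMk Q lam (FreeAlgebra.ι ℂ (PathGen.vertex i)) = preVertex Q lam i := rfl

theorem preMk_arrow (lam : I → ℂ) {i j : I} (a : (double Q).Hom i j) :
    preMk Q lam (FreeAlgebra.ι ℂ (PathGen.arrow a)) = preArrow lam a := rfl

theorem preVertex_mul_self (lam : I → ℂ) (i : I) :
    preVertex Q lam i * preVertex Q lam i = preVertex Q lam i := by
  rw [← preMk_vertex, ← map_mul, preMk_rel lam (PathRel.idem i)]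

theorem preVertex_mul_of_ne (lam : I → ℂ) {i j : I} (h : i ≠ j) :
    preVertex Q lam i * preVertex Q lam j = 0 := by
  rw [← preMk_vertex, ← preMk_vertex, ← map_mul, preMk_rel lam (PathRel.orth i j h), map_zero]

theorem sum_preVertex (lam : I → ℂ) : ∑ i, preVertex Q lam i = 1 := by
  simp only [← preMk_vertex]
  rw [← map_sum, preMk_rel lam PathRel.unit, map_one]

theorem preArrow_mul_preVertex (lam : I → ℂ) {i j : I} (a : (double Q).Hom i j) :
    preArrow lam a * preVertex Q lam i = preArrow lam a := by
  rw [← preMk_vertex, ← preMk_arrow, ← map_mul, preMk_rel lam (PathRel.tail a)]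

theorem preArrow_moment (lam : I → ℂ) :
    (∑ i : I, ∑ j : I, ∑ x : Q.Hom i j,
      (preArrow lam (pos x) * preArrow lam (rev x) -
        preArrow lam (rev x) * preArrow lam (pos x))) = ∑ i : I, lam i • preVertex Q lam i := by
  have h := RingQuot.mkAlgHom_rel ℂ (PreprojRel.moment (Q := Q) (lam := lam))
  simp only [map_sum, map_sub, map_mul, map_smul] at h
  exact h

theorem subalgebra_eq_top (lam : I → ℂ) (S : Subalgebra ℂ (Preproj Q lam))
    (hvert : ∀ i, preVertex Q lam i ∈ S)
    (harr : ∀ (i j : I) (a : (double Q).Hom i j), preArrow lam a ∈ S) (a : Preproj Q lam) :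
    a ∈ S := by
  obtain ⟨b, rfl⟩ : ∃ b, preMk Q lam b = a :=
    ((RingQuot.mkAlgHom_surjective ℂ _).comp (RingQuot.mkAlgHom_surjective ℂ _)) a
  induction b using FreeAlgebra.induction with
  | grade0 r => rw [AlgHom.commutes]; exact S.algebraMap_mem r
  | grade1 x =>
    cases x with
    | vertex i => exact hvert i
    | arrow a => exact harr _ _ a
  | mul a b ha hb => rw [map_mul]; exact S.mul_mem ha hb
  | add a b ha hb => rw [map_add]; exact S.add_mem ha hb

end PreprojectiveRelations

/-! ### Points given by simple modules: Schur's lemma. -/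

section SimpleModules

variable {I : Type u} [Fintype I] {Q : Quiver.{w} I} [∀ i j : I, Fintype (Q.Hom i j)]
variable (lam : I → ℂ) {M : Type t} [AddCommGroup M] [Module ℂ M] [Module (Preproj Q lam) M]
  [IsScalarTower ℂ (Preproj Q lam) M]

theorem preVertex_smul_mem (i : I) (m : M) :
    preVertex Q lam i • m ∈ vertexSpace (Q := Q) lam M i := ⟨m, rfl⟩

theorem preVertex_smul_of_mem {i : I} {m : M} (hm : m ∈ vertexSpace (Q := Q) lam M i) :
    preVertex Q lam i • m = m := by
  obtain ⟨n, rfl⟩ := hm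
  change preVertex Q lam i • preVertex Q lam i • n = preVertex Q lam i • n
  rw [smul_smul, preVertex_mul_self]

theorem preVertex_smul_of_ne {i j : I} (h : i ≠ j) {m : M}
    (hm : m ∈ vertexSpace (Q := Q) lam M j) : preVertex Q lam i • m = 0 := by
  rw [← preVertex_smul_of_mem lam hm, smul_smul, preVertex_mul_of_ne lam h, zero_smul]

theorem preArrow_smul_of_ne {i j k : I} (h : i ≠ k) (a : (double Q).Hom i j) {m : M}
    (hm : m ∈ vertexSpace (Q := Q) lam M k) : preArrow lam a • m = 0 := by
  rw [← preArrow_mul_preVertex, mul_smul, preVertex_smul_of_ne lam h hm, smul_zero]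

theorem coe_arrowMap {i j : I} (a : (double Q).Hom i j) (m : vertexSpace (Q := Q) lam M i) :
    (arrowMap lam M a m : M) = preArrow lam a • (m : M) := rfl

omit [Module ℂ M] [IsScalarTower ℂ (Preproj Q lam) M] in
theorem sum_preVertex_smul (m : M) : ∑ i, preVertex Q lam i • m = m := by
  rw [← Finset.sum_smul, sum_preVertex, one_smul]

/-- The defining relation applied to a vector of `1_i M`: a product of arrows survives only if its
first factor to act starts at `i`. -/
theorem moment_arrowMap (i : I) :
    (∑ j : I, ∑ x : Q.Hom j i, arrowMap lam M (pos x) ∘ₗ arrowMap lam M (rev x)) -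
      ∑ j : I, ∑ x : Q.Hom i j, arrowMap lam M (rev x) ∘ₗ arrowMap lam M (pos x) =
    lam i • (LinearMap.id : vertexSpace (Q := Q) lam M i →ₗ[ℂ] _) := by
  ext ⟨m, hm⟩
  have h := congr_arg (fun a => a • m) (preArrow_moment (Q := Q) lam)
  have hsub : ∀ a b : Preproj Q lam, (a - b) • m = a • m - b • m := fun a b => sub_smul a b m
  simp only [Finset.sum_smul, hsub, Finset.sum_sub_distrib, mul_smul, smul_assoc] at h
  have h1 : ∑ k : I, ∑ j : I, ∑ x : Q.Hom k j,
      preArrow (Q := Q) lam (pos x) • preArrow (Q := Q) lam (rev x) • m =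
      ∑ j : I, ∑ x : Q.Hom j i,
        preArrow (Q := Q) lam (pos x) • preArrow (Q := Q) lam (rev x) • m := by
    refine Finset.sum_congr rfl fun k _ => Finset.sum_eq_single i (fun j _ hj => ?_) (by simp)
    refine Finset.sum_eq_zero fun x _ => ?_
    rw [preArrow_smul_of_ne lam hj (rev x) hm, smul_zero]
  have h2 : ∑ k : I, ∑ j : I, ∑ x : Q.Hom k j,
      preArrow (Q := Q) lam (rev x) • preArrow (Q := Q) lam (pos x) • m =
      ∑ j : I, ∑ x : Q.Hom i j,
        preArrow (Q := Q) lam (rev x) • preArrow (Q := Q) lam (pos x) • m := by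
    refine Finset.sum_eq_single i (fun k _ hk => ?_) (by simp)
    refine Finset.sum_eq_zero fun j _ => Finset.sum_eq_zero fun x _ => ?_
    rw [preArrow_smul_of_ne lam hk (pos x) hm, smul_zero]
  have h3 : ∑ k : I, lam k • preVertex Q lam k • m = lam i • m := by
    rw [Finset.sum_eq_single i (fun k _ hk => ?_) (by simp), preVertex_smul_of_mem lam hm]
    rw [preVertex_smul_of_ne lam hk hm, smul_zero]
  rw [h1, h2, h3] at h
  simpa [coe_arrowMap] using h

variable {v : I → ℕ} (b : ∀ i : I, Module.Basis (Fin (v i)) ℂ (vertexSpace (Q := Q) lam M i))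

theorem pointOfModule_mem_fiber : pointOfModule lam M b ∈ fiber Q v lam := by
  intro i
  have h := congr_arg (LinearMap.toMatrix (b i) (b i)) (moment_arrowMap (M := M) (Q := Q) lam i)
  rw [map_smul, LinearMap.toMatrix_id, map_sub] at h
  rw [← h]
  simp only [map_sum, momentMap, pointOfModule]
  congr 1 <;> refine Finset.sum_congr rfl fun j _ => Finset.sum_congr rfl fun x _ =>
    (LinearMap.toMatrix_comp (b i) (b j) (b i) _ _).symm

include b in
theorem finite_of_bases : Module.Finite ℂ M := by
  have : ∀ i, Module.Finite ℂ (vertexSpace (Q := Q) lam M i) :=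
    fun i => Module.Finite.of_basis (b i)
  refine Module.Finite.of_surjective
    (∑ i, (vertexSpace (Q := Q) lam M i).subtype ∘ₗ LinearMap.proj i) fun m =>
      ⟨fun i => ⟨_, preVertex_smul_mem lam i m⟩, ?_⟩
  simpa using sum_preVertex_smul (Q := Q) lam m

/-- The projection of `M` onto `1_i M`. -/
def vertexProj (i : I) : M →ₗ[ℂ] vertexSpace (Q := Q) lam M i :=
  LinearMap.rangeRestrict (Algebra.lsmul ℂ ℂ M (preVertex Q lam i))

theorem coe_vertexProj (i : I) (m : M) :
    (vertexProj (Q := Q) lam i m : M) = preVertex Q lam i • m := rfl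

theorem vertexProj_coe (i : I) (m : vertexSpace (Q := Q) lam M i) :
    vertexProj lam i (m : M) = m := Subtype.ext (preVertex_smul_of_mem lam m.2)

theorem vertexProj_coe_of_ne {i j : I} (h : i ≠ j) (m : vertexSpace (Q := Q) lam M j) :
    vertexProj (Q := Q) lam i (m : M) = 0 := Subtype.ext (preVertex_smul_of_ne lam h m.2)

/-- The endomorphism of `M` with given diagonal blocks on the components `1_i M`. -/
def blockEnd (U : ∀ i, Module.End ℂ (vertexSpace (Q := Q) lam M i)) : Module.End ℂ M :=
  ∑ i, (vertexSpace (Q := Q) lam M i).subtype ∘ₗ U i ∘ₗ vertexProj lam i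

theorem blockEnd_apply (U : ∀ i, Module.End ℂ (vertexSpace (Q := Q) lam M i)) (m : M) :
    blockEnd lam U m = ∑ i, (U i (vertexProj lam i m) : M) := by
  simp [blockEnd]

theorem blockEnd_coe (U : ∀ i, Module.End ℂ (vertexSpace (Q := Q) lam M i)) {i : I}
    (m : vertexSpace (Q := Q) lam M i) : blockEnd lam U (m : M) = U i m := by
  rw [blockEnd_apply, Finset.sum_eq_single i, vertexProj_coe]
  · intro j _ hj
    rw [vertexProj_coe_of_ne lam hj, map_zero, Submodule.coe_zero]
  · simp

theorem blockEnd_smul (U : ∀ i, Module.End ℂ (vertexSpace (Q := Q) lam M i))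
    (hU : ∀ (i j : I) (a : (double Q).Hom i j),
      U j ∘ₗ arrowMap lam M a = arrowMap lam M a ∘ₗ U i)
    (a : Preproj Q lam) (m : M) : blockEnd lam U (a • m) = a • blockEnd lam U m := by
  -- The elements whose action commutes with a given endomorphism form a subalgebra, so vertices and
  -- arrows suffice.
  have key : a ∈ (Subalgebra.centralizer ℂ {blockEnd lam U}).comap (Algebra.lsmul ℂ ℂ M) := by
    apply subalgebra_eq_top
    · intro i
      rw [Subalgebra.mem_comap, Subalgebra.mem_centralizer_iff]
      rintro _ rfl
      ext m
      change blockEnd lam U (preVertex Q lam i • m) = preVertex Q lam i • blockEnd lam U m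
      rw [← coe_vertexProj, blockEnd_coe, blockEnd_apply, Finset.smul_sum, Finset.sum_eq_single i,
        preVertex_smul_of_mem lam (U i _).2]
      · exact fun j _ hj => preVertex_smul_of_ne lam hj.symm (U j _).2
      · simp
    · intro i j a
      rw [Subalgebra.mem_comap, Subalgebra.mem_centralizer_iff]
      rintro _ rfl
      ext m
      change blockEnd lam U (preArrow lam a • m) = preArrow lam a • blockEnd lam U m
      rw [← preArrow_mul_preVertex, mul_smul, ← coe_vertexProj, ← coe_arrowMap, blockEnd_coe,
        preArrow_mul_preVertex, blockEnd_apply, Finset.smul_sum, Finset.sum_eq_single i]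
      · exact congr_arg Subtype.val (LinearMap.congr_fun (hU i j a) (vertexProj lam i m))
      · exact fun k _ hk => preArrow_smul_of_ne lam hk.symm a (U k _).2
      · simp
  rw [Subalgebra.mem_comap, Subalgebra.mem_centralizer_iff] at key
  exact LinearMap.congr_fun (key _ rfl) m

/-- Schur's lemma: over `ℂ` the endomorphism has an eigenvalue, and its eigenspace is a nonzero
submodule of a simple module. -/
theorem exists_eq_smul_of_isSimpleModule [IsSimpleModule (Preproj Q lam) M] [Module.Finite ℂ M]
    (φ : Module.End ℂ M) (hφ : ∀ (a : Preproj Q lam) (m : M), φ (a • m) = a • φ m) :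
    ∃ c : ℂ, ∀ m, φ m = c • m := by
  have := IsSimpleModule.nontrivial (Preproj Q lam) M
  obtain ⟨c, hc⟩ := Module.End.exists_eigenvalue φ
  let N : Submodule (Preproj Q lam) M :=
    { carrier := {m | φ m = c • m}
      add_mem' := fun {m n} (hm : _ = _) (hn : _ = _) => by
        change φ (m + n) = _
        rw [map_add, hm, hn, smul_add]
      zero_mem' := by simp
      smul_mem' := fun a m (hm : _ = _) => by
        change φ (a • m) = _
        rw [hφ, hm, smul_comm] }
  obtain ⟨m, hm, hm0⟩ := hc.exists_hasEigenvector
  have hS : IsSimpleOrder (Submodule (Preproj Q lam) M) :=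
    ‹IsSimpleModule (Preproj Q lam) M›.toIsSimpleOrder
  have hN : N = ⊤ := (eq_bot_or_eq_top N).resolve_left fun h => hm0 (by
    have : m ∈ N := Module.End.mem_eigenspace_iff.1 hm
    rwa [h, Submodule.mem_bot] at this)
  exact ⟨c, fun m => (hN ▸ Submodule.mem_top : m ∈ N)⟩

/-- In the chosen bases, `uα = 0` says that the blocks of `u` commute with all arrows, so together
they form a `Π_λ`-endomorphism of `M`, which is a scalar. -/
theorem hasScalarStabilizer_pointOfModule [IsSimpleModule (Preproj Q lam) M] :
    HasScalarStabilizer (pointOfModule lam M b) := by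
  intro u hu
  have := finite_of_bases lam b
  let U : ∀ i, Module.End ℂ (vertexSpace (Q := Q) lam M i) := fun i =>
    Matrix.toLin (b i) (b i) (u i)
  have hU : ∀ (i j : I) (a : (double Q).Hom i j),
      U j ∘ₗ arrowMap lam M a = arrowMap lam M a ∘ₗ U i := fun i j a => by
    apply (LinearMap.toMatrix (b i) (b j)).injective
    rw [LinearMap.toMatrix_comp (b i) (b j) (b j), LinearMap.toMatrix_comp (b i) (b i) (b j),
      LinearMap.toMatrix_toLin, LinearMap.toMatrix_toLin]
    exact sub_eq_zero.1 (congr_fun (congr_fun (congr_fun hu i) j) a)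
  obtain ⟨c, hc⟩ := exists_eq_smul_of_isSimpleModule lam (blockEnd lam U) (blockEnd_smul lam U hU)
  refine ⟨c, fun i => ?_⟩
  have h1 : U i = c • LinearMap.id := by
    ext m
    rw [← blockEnd_coe, hc]
    rfl
  have h2 := congr_arg (LinearMap.toMatrix (b i) (b i)) h1
  rwa [LinearMap.toMatrix_toLin, map_smul, LinearMap.toMatrix_id] at h2

end SimpleModules

end QuiverRep
end

theorem mainTheorem6 {I : Type u} [Fintype I] [DecidableEq I] (Q : Quiver.{w} I)
    [∀ i j : I, Fintype (Q.Hom i j)] (v : I → ℕ) (hv : v ≠ 0) (lam : I → ℂ) :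
    (∀ (M : Type t) [AddCommGroup M] [Module ℂ M] [Module (QuiverRep.Preproj Q lam) M]
      [IsScalarTower ℂ (QuiverRep.Preproj Q lam) M]
      [IsSimpleModule (QuiverRep.Preproj Q lam) M]
      (b : ∀ i : I, Module.Basis (Fin (v i)) ℂ (QuiverRep.vertexSpace (Q := Q) lam M i)),
      QuiverRep.pointOfModule lam M b ∈ QuiverRep.smoothLocus Q v lam) ∧
    ((∀ (g : QuiverRep.GroupV v ⧸ QuiverRep.scalars v),
        ∀ α ∈ QuiverRep.smoothLocus Q v lam, g • α ∈ QuiverRep.smoothLocus Q v lam) ∧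
      ∀ α ∈ QuiverRep.smoothLocus Q v lam,
        MulAction.stabilizer (QuiverRep.GroupV v ⧸ QuiverRep.scalars v) α = ⊥) ∧
    ∀ α ∈ QuiverRep.smoothLocus Q v lam,
      QuiverRep.orbitTangent α ≤ QuiverRep.tangentSpace lam α ∧
      (∃! ω : LinearMap.BilinForm ℂ (QuiverRep.NormalSpace lam α),
        (∀ β γ : QuiverRep.tangentSpace lam α,
          ω (Submodule.Quotient.mk β) (Submodule.Quotient.mk γ) =
            QuiverRep.omega Q v (β : QuiverRep.DoubleRep Q v ℂ)
              (γ : QuiverRep.DoubleRep Q v ℂ)) ∧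
        ω.IsAlt ∧ ω.Nondegenerate) ∧
      (Module.finrank ℂ (QuiverRep.NormalSpace lam α) : ℤ) =
        2 - (QuiverRep.cartan Q *ᵥ fun i => (v i : ℤ)) ⬝ᵥ fun i => (v i : ℤ) := by
  refine ⟨?_, ⟨?_, ?_⟩, ?_⟩
  · intro M _ _ _ _ _ b
    exact (QuiverRep.mem_smoothLocus_iff hv).2 ⟨QuiverRep.pointOfModule_mem_fiber lam b,
      QuiverRep.hasScalarStabilizer_pointOfModule lam b⟩
  · intro g α hα
    rw [QuiverRep.mem_smoothLocus_iff hv] at hα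
    induction g using QuotientGroup.induction_on with
    | H g =>
      exact (QuiverRep.mem_smoothLocus_iff hv).2
        ⟨QuiverRep.smul_mem_fiber hα.1 g, hα.2.smul g⟩
  · intro α hα
    exact QuiverRep.stabilizer_eq_bot hv ((QuiverRep.mem_smoothLocus_iff hv).1 hα).2
  · intro α hα
    have hf := ((QuiverRep.mem_smoothLocus_iff hv).1 hα).1
    exact ⟨QuiverRep.orbitTangent_le_tangentSpace hf,
      QuiverRep.existsUnique_symplectic_quotient QuiverRep.omega_nondegenerate
        QuiverRep.omega_isAlt (QuiverRep.tangentSpace_eq_orthogonal hf),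
      QuiverRep.finrank_normalSpace hv hα⟩
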